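/- Let $r,s\ge 1$, $n=r+s$, $J=I_r\oplus -I_{s}$, $[x,y]_J=y^*Jx$, and let $$A=\begin{bmatrix}\alpha I_r & C\\ D&\beta I_{s}\end{bmatrix}\in M_n(\mathbb C),\qquad \alpha\ne\beta,$$ with $C,D$ not both zero. Let $W^J(A)=W_+\cup(-W_-)$ be the Krein space numerical range, where $W_{\pm}=\{[Ax,x]_J: x\in\mathbb C^n,\ [x,x]_J=\pm1\}$. With $A^\#=JA^*J$, $\Re^J(A)=\frac12(A+A^\#)$ and $\Im^J(A)=\frac1{2i}(A-A^\#)$, let $C^J(A)$ be the real affine part of the algebraic curve with equation $\det(u\Re^J(A)+v\Im^J(A)+wI_n)=0$ in homogeneous line coordinates; its components are the real parts of the duals of the irreducible components of this equation. Suppose that $CD$ and $DC$ are both normal and let $p=\min\{r,s\}$. Then there are unitary matrices $U,V$ such that $V^*CU$ and $U^*DV$ are both (rectangular) diagonal, with diagonal entries $c_1,\dots,c_p$ and $d_1,\dots,d_p$, respectively. For any such $U,V$ let $\sigma_j=|c_j|$ and $\delta_j=|d_j|$ (the singular values of $C$ and of $D$, up to additional zeros), let $z_j=d_jc_j$ (the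 eigenvalues of $DC$ and of $CD$, up to additional zeros), and $$f_{j\pm}=\tfrac12(\alpha+\beta)\pm\tfrac12\sqrt{(\alpha-\beta)^2+4z_j},\qquad j=1,\dots,p.$$ If $$2\Re(\overline{f_{j+}}f_{j-})<|\alpha|^2+|\beta|^2-\sigma_j^2-\delta_j^2<|f_{j+}|^2+|f_{j-}|^2,\qquad j=1,\dots,p,$$ then the components of $C^J(A)$ are the (at most $p$, as some may coincide) non-degenerate hyperbolas $H_1,\dots,H_p$, where $H_j$ has foci $f_{j\pm}$ and non-transverse axis of length $$\sqrt{|f_{j+}|^2+|f_{j-}|^2-|\alpha|^2-|\beta|^2+\sigma_j^2+\delta_j^2},$$ together with the point $\alpha$ if $r>s$, and the point $\beta$ if $r<s$. Moreover $W^J(A)$ is the pseudo-convex hull of $H_1\cup\dots\cup H_p$. Here the pseudo-convex hull is generated as follows: a point $w=[Ax,x]_J/[x,x]_J$ of the given set carries the sign of $[x,x]_J$; one repeatedly adds, for points $w_1,w_2$ of the same sign, the points of the segment joining them, with that same sign, and, for points $w_1,w_2$ of opposite signs, the half-lines $\{tw_1+(1-t)w_2:t\ge1\}$, with the sign of $w_1$,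 and $\{tw_1+(1-t)w_2:t\le0\}$, with the sign of $w_2$. -/

import Mathlib

open scoped Matrix

noncomputable section

namespace KreinRange

section General

variable {n : Type*} [Fintype n] [DecidableEq n]

/-- The indefinite inner product `[x, y]_J = y^* J x`. -/
def ip (J : Matrix n n ℂ) (x y : n → ℂ) : ℂ := star y ⬝ᵥ (J *ᵥ x)

/-- `W_+^J(A) = {[Ax, x]_J : [x, x]_J = 1}`. -/
def rangePos (J A : Matrix n n ℂ) : Set ℂ :=
  {w | ∃ x : n → ℂ, ip J x x = 1 ∧ w = ip J (A *ᵥ x) x}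

/-- `-W_-^J(A)`, where `W_-^J(A) = {[Ax, x]_J : [x, x]_J = -1}`. -/
def negRangeNeg (J A : Matrix n n ℂ) : Set ℂ :=
  {w | ∃ x : n → ℂ, ip J x x = -1 ∧ w = -ip J (A *ᵥ x) x}

/-- The Krein space numerical range `W^J(A) = -W_-^J(A) ∪ W_+^J(A)`. -/
def numRange (J A : Matrix n n ℂ) : Set ℂ := negRangeNeg J A ∪ rangePos J A

/-- The `J`-adjoint `A^# = J A^* J`. -/
def adj (J A : Matrix n n ℂ) : Matrix n n ℂ := J * Aᴴ * J

/-- `Re^J(A) = (A + A^#) / 2`. -/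
def reJ (J A : Matrix n n ℂ) : Matrix n n ℂ := (1 / 2 : ℂ) • (A + adj J A)

/-- `Im^J(A) = (A - A^#) / (2i)`. -/
def imJ (J A : Matrix n n ℂ) : Matrix n n ℂ := (1 / (2 * Complex.I) : ℂ) • (A - adj J A)

/-- The polynomial `det (u Re^J(A) + v Im^J(A) + w I)` in the line coordinates
`u = X 0`, `v = X 1`, `w = X 2`. -/
def linePoly (J A : Matrix n n ℂ) : MvPolynomial (Fin 3) ℂ :=
  Matrix.det
    ((MvPolynomial.X 0 : MvPolynomial (Fin 3) ℂ) • (reJ J A).map MvPolynomial.C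
      + (MvPolynomial.X 1 : MvPolynomial (Fin 3) ℂ) • (imJ J A).map MvPolynomial.C
      + (MvPolynomial.X 2 : MvPolynomial (Fin 3) ℂ) • 1)

end General

/-- The gradient of `q` at `Q`. When `q Q = 0` and the gradient is not zero, it gives the
homogeneous coordinates of the tangent line at `Q` of the curve `q = 0`. -/
def grad (q : MvPolynomial (Fin 3) ℂ) (Q : Fin 3 → ℂ) : Fin 3 → ℂ :=
  fun i => MvPolynomial.eval Q (MvPolynomial.pderiv i q)

/-- `P` (homogeneous coordinates) lies on the dual of the curve `q = 0`: the Zariski closure,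
in the complex projective plane, of the set of the tangents of `q = 0` at its smooth points. -/
def OnDual (q : MvPolynomial (Fin 3) ℂ) (P : Fin 3 → ℂ) : Prop :=
  ∀ (d : ℕ) (g : MvPolynomial (Fin 3) ℂ), g.IsHomogeneous d →
    (∀ Q : Fin 3 → ℂ, MvPolynomial.eval Q q = 0 → grad q Q ≠ 0 →
      MvPolynomial.eval (grad q Q) g = 0) →
    MvPolynomial.eval P g = 0

/-- The real affine part of the dual of `q = 0`, where `x + iy` stands for `(x : y : 1)`. -/
def realDual (q : MvPolynomial (Fin 3) ℂ) : Set ℂ :=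
  {z | OnDual q ![(z.re : ℂ), (z.im : ℂ), 1]}

section General

variable {n : Type*} [Fintype n] [DecidableEq n]

/-- The components of the indefinite Kippenhahn curve: the real parts of the duals of the
irreducible components of `det (u Re^J(A) + v Im^J(A) + w I) = 0`. -/
def components (J A : Matrix n n ℂ) : Set (Set ℂ) :=
  {K | ∃ q : MvPolynomial (Fin 3) ℂ, Irreducible q ∧ q ∣ linePoly J A ∧ K = realDual q}

/-- The indefinite Kippenhahn curve `C^J(A)`: the real part of the algebraic curve whose
equation in homogeneous line coordinates is `det (u Re^J(A) + v Im^J(A) + w I) = 0`. -/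
def kippenhahn (J A : Matrix n n ℂ) : Set ℂ := ⋃₀ components J A

/-- The pseudo-convex hull of points that carry signs: `P true` are the points of sign `+`,
`P false` those of sign `-`. Two points of the same sign are joined by the segment between them,
two points of opposite signs by the two half-lines `t w₁ + (1 - t) w₂` with `t ≥ 1` (points with
the sign of `w₁`) or `t ≤ 0` (points with the sign of `w₂`; the rule `ray` with `w₁`, `w₂`
exchanged). -/
inductive SignedHull (P : Bool → Set ℂ) : Bool → ℂ → Prop
  | base (s : Bool) (w : ℂ) (hw : w ∈ P s) : SignedHull P s w
  | segment (s : Bool) (w₁ w₂ : ℂ) (t : ℝ) (h₁ : SignedHull P s w₁) (h₂ : SignedHull P s w₂)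
      (h0 : 0 ≤ t) (h1 : t ≤ 1) : SignedHull P s (t * w₁ + (1 - t) * w₂)
  | ray (s : Bool) (w₁ w₂ : ℂ) (t : ℝ) (h₁ : SignedHull P s w₁) (h₂ : SignedHull P (!s) w₂)
      (ht : 1 ≤ t) : SignedHull P s (t * w₁ + (1 - t) * w₂)

/-- The signs of the points `[Ax, x]_J / [x, x]_J` of `S`: the sign of `[x, x]_J`. -/
def signed (J A : Matrix n n ℂ) (S : Set ℂ) : Bool → Set ℂ
  | true => S ∩ rangePos J A
  | false => S ∩ negRangeNeg J A

/-- The pseudo-convex hull of a set `S`, with respect to `J` and `A`. -/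
def pseudoConvexHull (J A : Matrix n n ℂ) (S : Set ℂ) : Set ℂ :=
  {z | ∃ s : Bool, SignedHull (signed J A S) s z}

end General

/-- `S` is the non-degenerate hyperbola with foci `f₁`, `f₂` and non-transverse axis of length
`b`; the transverse axis then has length `a` with `a ^ 2 + b ^ 2 = |f₁ - f₂| ^ 2`. -/
def IsHyperbola (f₁ f₂ : ℂ) (b : ℝ) (S : Set ℂ) : Prop :=
  0 < b ∧ ∃ a : ℝ, 0 < a ∧ a ^ 2 + b ^ 2 = dist f₁ f₂ ^ 2 ∧
    S = {z | |dist z f₁ - dist z f₂| = a}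

/-- `J = I_r ⊕ -I_s`. -/
def inertia (r s : ℕ) : Matrix (Fin r ⊕ Fin s) (Fin r ⊕ Fin s) ℂ :=
  Matrix.fromBlocks 1 0 0 (-1)

/-- The block matrix with diagonal blocks `α I_r`, `β I_s` and off-diagonal blocks `C`, `D`. -/
def blockMatrix {r s : ℕ} (α β : ℂ) (C : Matrix (Fin r) (Fin s) ℂ) (D : Matrix (Fin s) (Fin r) ℂ) :
    Matrix (Fin r ⊕ Fin s) (Fin r ⊕ Fin s) ℂ :=
  Matrix.fromBlocks (α • 1) C D (β • 1)

/-- The rectangular diagonal matrix with diagonal entries `c`. -/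
def rectDiag {p : ℕ} (m k : ℕ) (c : Fin p → ℂ) : Matrix (Fin m) (Fin k) ℂ :=
  Matrix.of fun i j => if h : i.1 < p then (if i.1 = j.1 then c ⟨i.1, h⟩ else 0) else 0

/-- Corresponding labellings of the singular values `σ j` of `C`, the singular values `δ j` of `D`
and the eigenvalues `z j` of `DC` and `CD` (up to additional zeros when `r ≠ s`), read off a
simultaneous singular value decomposition `C = V diag(c) U^*`, `D = U diag(d) V^*` with `U`, `V`
unitary: `σ j = |c j|`, `δ j = |d j|`, `z j = d j * c j`. -/
def JointLabelling {r s : ℕ} (C : Matrix (Fin r) (Fin s) ℂ) (D : Matrix (Fin s) (Fin r) ℂ)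
    (σ δ : Fin (min r s) → ℝ) (z : Fin (min r s) → ℂ) : Prop :=
  ∃ U ∈ Matrix.unitaryGroup (Fin s) ℂ, ∃ V ∈ Matrix.unitaryGroup (Fin r) ℂ,
    ∃ c d : Fin (min r s) → ℂ,
      C = V * rectDiag r s c * Uᴴ ∧ D = U * rectDiag s r d * Vᴴ ∧
      ∀ j, σ j = ‖c j‖ ∧ δ j = ‖d j‖ ∧ z j = d j * c j

/-- `f_+ = (α + β) / 2 + √((α - β)² + 4z) / 2`. -/
def focusPlus (α β z : ℂ) : ℂ := (α + β) / 2 + ((α - β) ^ 2 + 4 * z) ^ (1 / 2 : ℂ) / 2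

/-- `f_- = (α + β) / 2 - √((α - β)² + 4z) / 2`. -/
def focusMinus (α β z : ℂ) : ℂ := (α + β) / 2 - ((α - β) ^ 2 + 4 * z) ^ (1 / 2 : ℂ) / 2

end KreinRange

end

/-!
The Krein space numerical range and the indefinite Kippenhahn curve do not change under a unitary
change of basis that commutes with `J`. When `C * D` and `D * C` are normal, `C` and `Dᴴ` have a
simultaneous singular value decomposition (`exists_joint_svd`): by Fuglede's theorem `Cᴴ * C`
commutes with `D * C`, a common eigenvector gives a joint singular pair, and one splits it off. So
the matrix may be taken to be an orthogonal sum of blocks with rows `α, c j` and `d j, β`, and of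
`|r - s|` scalars.

*The curve.* The line polynomial is then a product of powers of linear forms, which are dual to
the points `α` and `β`, and of one quadratic factor for each block. With `g = (α + β) / 2`,
`e = (α - β) / 2` and `p ^ 2 = e ^ 2 + d * c`, that factor is the product of the equations of the
foci `g + p`, `g - p` plus a multiple `k` of `X 0 ^ 2 + X 1 ^ 2` (`pointPoly_mul_sub`). The two
inequalities of the hypothesis say `0 < k < ‖p‖ ^ 2`. Hence the conic is nonsingular, which makes
it irreducible, and its dual is a hyperbola with the right foci and axis (`realDual_conicPoly`,
`hyperbolaEq_iff_abs_dist_sub_dist`). Unique factorisation yields the components.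

*The hull lies in the range.* The two signed parts of the range of any matrix are closed under
the segment rule and under the half-line rule (`rangePos_segment`, `rangePos_ray`).

*The range lies in the hull.* All blocks have the same centre `g`. For a vector `x` of square `1`
with components `(a i, b i)`, the centred value is `T e + ∑ i, (c i ζ i - d i (ζ i)^*)` with
`T = ‖x‖ ^ 2` and `ζ i = (a i)^* b i`, and the Cauchy-Schwarz inequality gives
`T ^ 2 ≥ 1 + 4 (∑ i, |ζ i|) ^ 2`. Distributing `T` in proportion to the `|ζ i|` exhibits the value
as a convex combination of points `T e + c i ζ - d i ζ^*` with `T ^ 2 ≥ 1 + 4 |ζ| ^ 2`, each of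
which belongs to a single block (`sum_blockVal_mem_of_convex`); isotropic components of `x` cause
no trouble, and no half-lines are needed. Finally each such point lies on a segment between two
points of one branch of the hyperbola of its block, found by moving the coordinate of its polar
line until the dual quadratic form drops to `1` (`exists_hyperbola_segment`). The case of square
`-1` is the reflection of this in the centre.
-/

noncomputable section

namespace KreinRange

/-! ### Simultaneous singular value decomposition -/

section JointSVD

variable {m k : Type*} [Fintype m] [Fintype k]

open scoped ComplexOrder in
/-- Fuglede's theorem for a rectangular intertwiner: if `D * C` and `C * D` are normal, then `C`,
which satisfies `C * (D * C) = (C * D) * C`, also intertwines the adjoints. The Frobenius norm of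
the difference vanishes, because its four terms agree up to cyclic permutation of the trace. -/
theorem mul_conjTranspose_mul_of_isStarNormal (C : Matrix m k ℂ) (D : Matrix k m ℂ)
    (hCD : IsStarNormal (C * D)) (hDC : IsStarNormal (D * C)) :
    C * (D * C)ᴴ = (C * D)ᴴ * C := by
  have hN : (D * C)ᴴ * (D * C) = (D * C) * (D * C)ᴴ := hDC.star_comm_self
  have hM : (C * D)ᴴ * (C * D) = (C * D) * (C * D)ᴴ := hCD.star_comm_self
  rw [← sub_eq_zero, ← Matrix.trace_conjTranspose_mul_self_eq_zero_iff]
  set N := D * C with hNdef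
  set M := C * D with hMdef
  have hi : M * C = C * N := by rw [hNdef, hMdef, Matrix.mul_assoc]
  have hi' : Cᴴ * Mᴴ = Nᴴ * Cᴴ := by
    rw [← Matrix.conjTranspose_mul, hi, Matrix.conjTranspose_mul]
  have e : (C * Nᴴ - Mᴴ * C)ᴴ * (C * Nᴴ - Mᴴ * C)
      = N * (Cᴴ * C * Nᴴ) - N * (Nᴴ * (Cᴴ * C)) - (Cᴴ * C) * (N * Nᴴ)
        + Nᴴ * ((Cᴴ * C) * N) := by
    have h1 : Cᴴ * M * (C * Nᴴ) = (Cᴴ * C) * (N * Nᴴ) := by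
      rw [Matrix.mul_assoc, ← Matrix.mul_assoc M, hi]; simp only [Matrix.mul_assoc]
    have h2 : N * Cᴴ * (Mᴴ * C) = N * (Nᴴ * (Cᴴ * C)) := by
      rw [Matrix.mul_assoc, ← Matrix.mul_assoc Cᴴ, hi']; simp only [Matrix.mul_assoc]
    have h3 : Cᴴ * M * (Mᴴ * C) = Nᴴ * ((Cᴴ * C) * N) := by
      calc Cᴴ * M * (Mᴴ * C) = Cᴴ * ((M * Mᴴ) * C) := by simp only [Matrix.mul_assoc]
        _ = (Cᴴ * Mᴴ) * (M * C) := by rw [← hM]; simp only [Matrix.mul_assoc]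
        _ = _ := by rw [hi, hi']; simp only [Matrix.mul_assoc]
    simp only [Matrix.conjTranspose_sub, Matrix.conjTranspose_mul,
      Matrix.conjTranspose_conjTranspose, Matrix.sub_mul, Matrix.mul_sub, h1, h2, h3]
    simp only [Matrix.mul_assoc]
    abel
  have t1 : (N * (Cᴴ * C * Nᴴ)).trace = ((Cᴴ * C) * (N * Nᴴ)).trace := by
    rw [Matrix.trace_mul_comm, Matrix.mul_assoc, hN]
  have t2 : (N * (Nᴴ * (Cᴴ * C))).trace = ((Cᴴ * C) * (N * Nᴴ)).trace := by
    rw [← Matrix.mul_assoc, Matrix.trace_mul_comm]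
  have t3 : (Nᴴ * ((Cᴴ * C) * N)).trace = ((Cᴴ * C) * (N * Nᴴ)).trace := by
    rw [Matrix.trace_mul_comm, Matrix.mul_assoc]
  rw [e, Matrix.trace_add, Matrix.trace_sub, Matrix.trace_sub, t1, t2, t3]
  ring

/-- Commuting matrices share an eigenvector inside any eigenspace of the first one. -/
theorem exists_common_eigenvector (P N : Matrix k k ℂ) (h : Commute P N) (t : ℂ) (w : k → ℂ)
    (hw : w ≠ 0) (hPw : P *ᵥ w = t • w) :
    ∃ u : k → ℂ, u ≠ 0 ∧ P *ᵥ u = t • u ∧ ∃ z : ℂ, N *ᵥ u = z • u := by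
  classical
  set E : Submodule ℂ (k → ℂ) := LinearMap.ker (P.mulVecLin - t • LinearMap.id) with hE
  have hmem : ∀ x, x ∈ E ↔ P *ᵥ x = t • x := fun x => by
    simp [hE, LinearMap.mem_ker, sub_eq_zero]
  have hN : ∀ x ∈ E, N.mulVecLin x ∈ E := fun x hx => by
    rw [hmem] at hx ⊢
    rw [Matrix.mulVecLin_apply, Matrix.mulVec_mulVec, h.eq, ← Matrix.mulVec_mulVec, hx,
      Matrix.mulVec_smul]
  have : Nontrivial E := ⟨⟨⟨w, (hmem w).2 hPw⟩, 0, fun h0 => hw (congrArg Subtype.val h0)⟩⟩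
  obtain ⟨z, hz⟩ := Module.End.exists_eigenvalue (LinearMap.restrict N.mulVecLin hN)
  obtain ⟨u, hu⟩ := hz.exists_hasEigenvector
  refine ⟨u.1, fun h0 => hu.2 (Subtype.ext h0), (hmem _).1 u.2, z, ?_⟩
  simpa using congrArg Subtype.val hu.apply_eq_smul

theorem star_dotProduct_self_eq (u : k → ℂ) : star u ⬝ᵥ u = ((∑ i, ‖u i‖ ^ 2 : ℝ) : ℂ) := by
  simp [dotProduct, ← Complex.normSq_eq_norm_sq, Complex.normSq_eq_conj_mul_self]

theorem sum_norm_sq_pos {u : k → ℂ} (hu : u ≠ 0) : 0 < ∑ i, ‖u i‖ ^ 2 := by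
  obtain ⟨i, hi⟩ := Function.ne_iff.1 hu
  exact Finset.sum_pos' (fun _ _ => by positivity) ⟨i, Finset.mem_univ _, by
    have := norm_pos_iff.2 hi; positivity⟩

/-- A pair of unit vectors `u`, `v` that are joint singular vectors of `C` and of `D`. -/
def JointSingularPair (C : Matrix m k ℂ) (D : Matrix k m ℂ) (u : k → ℂ) (v : m → ℂ) : Prop :=
  star u ⬝ᵥ u = 1 ∧ star v ⬝ᵥ v = 1 ∧ ∃ c d : ℂ,
    C *ᵥ u = c • v ∧ Cᴴ *ᵥ v = star c • u ∧ D *ᵥ v = d • u ∧ Dᴴ *ᵥ u = star d • v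

open scoped ComplexOrder in
/-- For a normal matrix, eigenvectors are eigenvectors of the adjoint. -/
theorem conjTranspose_mulVec_of_isStarNormal {M : Matrix m m ℂ} (hM : IsStarNormal M)
    {v : m → ℂ} {z : ℂ} (h : M *ᵥ v = z • v) : Mᴴ *ᵥ v = star z • v := by
  classical
  set T := M - z • (1 : Matrix m m ℂ) with hT
  have hMc : Mᴴ * M = M * Mᴴ := hM.star_comm_self
  have hTn : T * Tᴴ = Tᴴ * T := by
    simp only [hT, Matrix.conjTranspose_sub, Matrix.conjTranspose_smul, Matrix.conjTranspose_one,
      Matrix.sub_mul, Matrix.mul_sub, Matrix.smul_mul, Matrix.mul_smul, Matrix.one_mul,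
      Matrix.mul_one, hMc, smul_sub, smul_comm z (star z)]
    abel
  have h0 : T *ᵥ v = 0 := by
    simp [hT, Matrix.sub_mulVec, Matrix.smul_mulVec, h]
  have h1 : star (Tᴴ *ᵥ v) ⬝ᵥ (Tᴴ *ᵥ v) = 0 := by
    rw [Matrix.star_mulVec, Matrix.conjTranspose_conjTranspose, ← Matrix.dotProduct_mulVec,
      Matrix.mulVec_mulVec, hTn, ← Matrix.mulVec_mulVec, h0, Matrix.mulVec_zero, dotProduct_zero]
  have h2 := dotProduct_star_self_eq_zero.1 h1
  have h3 : Tᴴ *ᵥ v = Mᴴ *ᵥ v - star z • v := by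
    simp [hT, Matrix.sub_mulVec, Matrix.smul_mulVec, Matrix.conjTranspose_sub,
      Matrix.conjTranspose_smul]
  exact sub_eq_zero.1 (h3 ▸ h2)

open scoped ComplexOrder in
theorem exists_jointSingularPair (C : Matrix m k ℂ) (D : Matrix k m ℂ)
    (hCD : IsStarNormal (C * D)) (hDC : IsStarNormal (D * C)) (hC : C ≠ 0) :
    ∃ u v, JointSingularPair C D u v := by
  classical
  have hP : (Cᴴ * C).IsHermitian := Matrix.isHermitian_conjTranspose_mul_self C
  have hP0 : Cᴴ * C ≠ 0 := fun h => hC (Matrix.conjTranspose_mul_self_eq_zero.1 h)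
  obtain ⟨i, hi⟩ := Function.ne_iff.1 (fun h => hP0 (hP.eigenvalues_eq_zero_iff.1 h))
  have hF := mul_conjTranspose_mul_of_isStarNormal C D hCD hDC
  -- the adjoint of the intertwining relation makes `Cᴴ * C` commute with `D * C`
  have hcomm : Commute (Cᴴ * C) (D * C) := by
    have h1 : (D * C) * Cᴴ = Cᴴ * (C * D) := by
      simpa [Matrix.conjTranspose_mul] using congrArg Matrix.conjTranspose hF
    change Cᴴ * C * (D * C) = D * C * (Cᴴ * C)
    rw [← Matrix.mul_assoc (D * C), h1]
    simp only [Matrix.mul_assoc]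
  obtain ⟨u₀, hu₀, hPu₀, z, hz₀⟩ := exists_common_eigenvector (Cᴴ * C) (D * C) hcomm
    (hP.eigenvalues i : ℂ) (hP.eigenvectorBasis i)
    (fun h => hP.eigenvectorBasis.toBasis.ne_zero i (by
      ext j; simpa using congrFun h j))
    (by simpa using hP.mulVec_eigenvectorBasis i)
  set t : ℝ := hP.eigenvalues i with ht
  have ht0 : t ≠ 0 := hi
  -- `u` is the unit multiple of `u₀`, and `v` below that of `C *ᵥ u`
  set n0 := √(∑ i, ‖u₀ i‖ ^ 2) with hn0
  have hn0p : 0 < n0 := Real.sqrt_pos.2 (sum_norm_sq_pos hu₀)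
  set u : k → ℂ := ((n0 : ℂ)⁻¹) • u₀ with hu
  have huu : star u ⬝ᵥ u = 1 := by
    rw [hu, star_smul, smul_dotProduct, dotProduct_smul, star_dotProduct_self_eq,
      ← Real.sq_sqrt (sum_norm_sq_pos hu₀).le, ← hn0]
    have : (n0 : ℂ) ≠ 0 := by exact_mod_cast hn0p.ne'
    simp only [smul_eq_mul, star_inv₀, Complex.star_def, Complex.conj_ofReal]
    push_cast; field_simp
  have hPu : (Cᴴ * C) *ᵥ u = (t : ℂ) • u := by
    rw [hu, Matrix.mulVec_smul, hPu₀, smul_comm]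
  have hz : (D * C) *ᵥ u = z • u := by rw [hu, Matrix.mulVec_smul, hz₀, smul_comm]
  have hCu : star (C *ᵥ u) ⬝ᵥ (C *ᵥ u) = (t : ℂ) := by
    rw [Matrix.star_mulVec, ← Matrix.dotProduct_mulVec, Matrix.mulVec_mulVec, hPu,
      dotProduct_smul, huu]; simp
  have htp : 0 < t := by
    have h1 : t = ∑ i, ‖(C *ᵥ u) i‖ ^ 2 := by
      have := hCu; rw [star_dotProduct_self_eq] at this; exact_mod_cast this.symm
    exact lt_of_le_of_ne (h1 ▸ Finset.sum_nonneg fun _ _ => by positivity) ht0.symm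
  have hτ : ((√t : ℝ) : ℂ) ≠ 0 := by exact_mod_cast (Real.sqrt_pos.2 htp).ne'
  have hττ : ((√t : ℝ) : ℂ) * (√t : ℝ) = (t : ℂ) := by exact_mod_cast Real.mul_self_sqrt htp.le
  have htc : (t : ℂ) ≠ 0 := by exact_mod_cast ht0
  set v : m → ℂ := ((√t : ℝ) : ℂ)⁻¹ • (C *ᵥ u) with hv
  have hMv : (C * D) *ᵥ v = z • v := by
    rw [hv, Matrix.mulVec_smul, Matrix.mulVec_mulVec, Matrix.mul_assoc, ← Matrix.mulVec_mulVec, hz,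
      Matrix.mulVec_smul, smul_comm]
  have hMv' := conjTranspose_mulVec_of_isStarNormal hCD hMv
  have hCv : Cᴴ *ᵥ v = ((√t : ℝ) : ℂ) • u := by
    rw [hv, Matrix.mulVec_smul, Matrix.mulVec_mulVec, hPu, smul_smul, ← hττ]
    congr 1; field_simp
  refine ⟨u, v, huu, ?_, (√t : ℝ), z / (√t : ℝ), ?_, ?_, ?_, ?_⟩
  · rw [hv, star_smul, smul_dotProduct, dotProduct_smul, hCu]
    simp only [smul_eq_mul, star_inv₀, Complex.star_def, Complex.conj_ofReal]
    rw [← hττ]; field_simp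
  · rw [hv, smul_smul, mul_inv_cancel₀ hτ, one_smul]
  · rw [hCv]; simp
  · rw [hv, Matrix.mulVec_smul, Matrix.mulVec_mulVec, hz, smul_smul, div_eq_inv_mul]
  · rw [Matrix.conjTranspose_mul, ← Matrix.mulVec_mulVec, hCv, Matrix.mulVec_smul] at hMv'
    have h5 := congrArg (fun x => ((√t : ℝ) : ℂ)⁻¹ • x) hMv'
    simp only [smul_smul, inv_mul_cancel₀ hτ, one_smul] at h5
    rw [h5]
    simp [div_eq_inv_mul]

end JointSVD

/-- The block sum of the scalar `a` and the matrix `M`, indexed so that the scalar comes first. -/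
def consBlock {r s : ℕ} (a : ℂ) (M : Matrix (Fin r) (Fin s) ℂ) :
    Matrix (Fin (r + 1)) (Fin (s + 1)) ℂ :=
  Matrix.of (Fin.cons (Fin.cons a 0) fun i => Fin.cons 0 (M i))

section consBlock

variable {r s l : ℕ}

@[simp] theorem consBlock_zero_zero (a : ℂ) (M : Matrix (Fin r) (Fin s) ℂ) :
    consBlock a M 0 0 = a := rfl
@[simp] theorem consBlock_zero_succ (a : ℂ) (M : Matrix (Fin r) (Fin s) ℂ) (j : Fin s) :
    consBlock a M 0 j.succ = 0 := rfl
@[simp] theorem consBlock_succ_zero (a : ℂ) (M : Matrix (Fin r) (Fin s) ℂ) (i : Fin r) :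
    consBlock a M i.succ 0 = 0 := rfl
@[simp] theorem consBlock_succ_succ (a : ℂ) (M : Matrix (Fin r) (Fin s) ℂ) (i : Fin r)
    (j : Fin s) : consBlock a M i.succ j.succ = M i j := rfl

theorem consBlock_mul (a b : ℂ) (M : Matrix (Fin r) (Fin s) ℂ) (N : Matrix (Fin s) (Fin l) ℂ) :
    consBlock a M * consBlock b N = consBlock (a * b) (M * N) := by
  ext i j
  refine Fin.cases ?_ (fun i => ?_) i <;> refine Fin.cases ?_ (fun j => ?_) j <;>
    simp [Matrix.mul_apply, Fin.sum_univ_succ]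

theorem consBlock_conjTranspose (a : ℂ) (M : Matrix (Fin r) (Fin s) ℂ) :
    (consBlock a M)ᴴ = consBlock (star a) Mᴴ := by
  ext i j
  refine Fin.cases ?_ (fun i => ?_) i <;> refine Fin.cases ?_ (fun j => ?_) j <;>
    simp [Matrix.conjTranspose_apply]

theorem consBlock_one : consBlock 1 (1 : Matrix (Fin r) (Fin r) ℂ) = 1 := by
  ext i j
  refine Fin.cases ?_ (fun i => ?_) i <;> refine Fin.cases ?_ (fun j => ?_) j <;>
    simp [Matrix.one_apply, Fin.succ_ne_zero, eq_comm]

theorem eq_of_consBlock_eq {a b : ℂ} {M N : Matrix (Fin r) (Fin s) ℂ}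
    (h : consBlock a M = consBlock b N) : M = N := by
  ext i j
  simpa using congrFun (congrFun h i.succ) j.succ

theorem isStarNormal_of_consBlock {a : ℂ} {M : Matrix (Fin r) (Fin r) ℂ}
    (h : IsStarNormal (consBlock a M)) : IsStarNormal M := by
  have h1 : (consBlock a M)ᴴ * consBlock a M = consBlock a M * (consBlock a M)ᴴ := h.star_comm_self
  rw [consBlock_conjTranspose, consBlock_mul, consBlock_mul] at h1
  exact ⟨eq_of_consBlock_eq h1⟩

theorem consBlock_mem_unitaryGroup {M : Matrix (Fin r) (Fin r) ℂ}
    (h : M ∈ Matrix.unitaryGroup (Fin r) ℂ) :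
    consBlock 1 M ∈ Matrix.unitaryGroup (Fin (r + 1)) ℂ := by
  rw [Matrix.mem_unitaryGroup_iff, Matrix.star_eq_conjTranspose] at h ⊢
  rw [consBlock_conjTranspose, consBlock_mul, h, star_one, one_mul, consBlock_one]

end consBlock

/-- The rectangular matrix with the entries of the sequence `c` on its diagonal. -/
def seqDiag {R : Type*} [Zero R] (r s : ℕ) (c : ℕ → R) : Matrix (Fin r) (Fin s) R :=
  Matrix.of fun i j => if i.1 = j.1 then c i.1 else 0

theorem consBlock_seqDiag (r s : ℕ) (a : ℂ) (c : ℕ → ℂ) :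
    consBlock a (seqDiag r s c)
      = seqDiag (r + 1) (s + 1) (fun n => Nat.casesOn n a c) := by
  ext i j
  refine Fin.cases ?_ (fun i => ?_) i <;> refine Fin.cases ?_ (fun j => ?_) j <;>
    simp [seqDiag]

/-- Every unit vector is the first column of a unitary matrix. -/
theorem exists_unitary_col_zero {s : ℕ} (u : Fin (s + 1) → ℂ) (hu : star u ⬝ᵥ u = 1) :
    ∃ U ∈ Matrix.unitaryGroup (Fin (s + 1)) ℂ, U *ᵥ Pi.single 0 1 = u := by
  have hu1 : ‖WithLp.toLp 2 u‖ = 1 := by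
    rw [EuclideanSpace.norm_eq, Real.sqrt_eq_one]
    rw [star_dotProduct_self_eq] at hu
    exact_mod_cast hu
  obtain ⟨b, hb⟩ := Orthonormal.exists_orthonormalBasis_extension_of_card_eq (𝕜 := ℂ)
    (E := EuclideanSpace ℂ (Fin (s + 1))) (ι := Fin (s + 1)) (by simp)
    (v := fun _ => WithLp.toLp 2 u) (s := {0}) (by
      constructor
      · intro i; simpa using hu1
      · intro i j hij; exact absurd (Subsingleton.elim i j) hij)
  refine ⟨Matrix.of fun i j => b j i, ?_, ?_⟩
  · rw [Matrix.mem_unitaryGroup_iff']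
    ext i j
    have h1 := b.inner_eq_ite i j
    rw [EuclideanSpace.inner_eq_star_dotProduct, dotProduct_comm] at h1
    simpa [Matrix.mul_apply, Matrix.one_apply, dotProduct] using h1
  · ext i
    simp [hb 0 rfl]

theorem JointSingularPair.swap {m k : Type*} [Fintype m] [Fintype k] {C : Matrix m k ℂ}
    {D : Matrix k m ℂ} {u : k → ℂ} {v : m → ℂ} (h : JointSingularPair D C v u) :
    JointSingularPair C D u v := by
  obtain ⟨hu, hv, c, d, h1, h2, h3, h4⟩ := h
  exact ⟨hv, hu, d, c, h3, h4, h1, h2⟩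

/-- A matrix that maps `e₀` to a multiple of `e₀`, and whose adjoint does too, is a block sum. -/
theorem exists_eq_consBlock {r s : ℕ} (M : Matrix (Fin (r + 1)) (Fin (s + 1)) ℂ) (c : ℂ)
    (h1 : M *ᵥ Pi.single 0 1 = c • Pi.single 0 1)
    (h2 : Mᴴ *ᵥ Pi.single 0 1 = star c • Pi.single 0 1) :
    ∃ M', M = consBlock c M' := by
  refine ⟨M.submatrix Fin.succ Fin.succ, ?_⟩
  ext i j
  refine Fin.cases ?_ (fun i => ?_) i <;> refine Fin.cases ?_ (fun j => ?_) j
  · simpa using congrFun h1 0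
  · simpa using congrFun h2 j.succ
  · simpa using congrFun h1 i.succ
  · simp

/-- A simultaneous singular value decomposition of `C` and `Dᴴ`, with complex diagonal entries,
obtained by splitting off one joint singular pair at a time. -/
theorem exists_joint_svd (r s : ℕ) (C : Matrix (Fin r) (Fin s) ℂ) (D : Matrix (Fin s) (Fin r) ℂ)
    (hCD : IsStarNormal (C * D)) (hDC : IsStarNormal (D * C)) :
    ∃ U ∈ Matrix.unitaryGroup (Fin s) ℂ, ∃ V ∈ Matrix.unitaryGroup (Fin r) ℂ, ∃ c d : ℕ → ℂ,
      C = V * seqDiag r s c * Uᴴ ∧ D = U * seqDiag s r d * Vᴴ := by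
  induction r generalizing s with
  | zero =>
    exact ⟨1, one_mem _, 1, one_mem _, 0, 0, Subsingleton.elim _ _, Subsingleton.elim _ _⟩
  | succ r ih =>
    by_cases h0 : C = 0 ∧ D = 0
    · refine ⟨1, one_mem _, 1, one_mem _, 0, 0, ?_, ?_⟩
      · rw [h0.1]; ext i j; simp [seqDiag]
      · rw [h0.2]; ext i j; simp [seqDiag]
    obtain _ | s := s
    · exact absurd ⟨Subsingleton.elim _ _, Subsingleton.elim _ _⟩ h0
    obtain ⟨u, v, hu, hv, c, d, h1, h2, h3, h4⟩ : ∃ u v, JointSingularPair C D u v := by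
      by_cases hC : C = 0
      · obtain ⟨v, u, h⟩ := exists_jointSingularPair D C hDC hCD fun hD => h0 ⟨hC, hD⟩
        exact ⟨u, v, h.swap⟩
      · exact exists_jointSingularPair C D hCD hDC hC
    obtain ⟨U, hU, rfl⟩ := exists_unitary_col_zero u hu
    obtain ⟨V, hV, rfl⟩ := exists_unitary_col_zero v hv
    have hU1 : Uᴴ * U = 1 := Matrix.mem_unitaryGroup_iff'.1 hU
    have hU2 : U * Uᴴ = 1 := Matrix.mem_unitaryGroup_iff.1 hU
    have hV1 : Vᴴ * V = 1 := Matrix.mem_unitaryGroup_iff'.1 hV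
    have hV2 : V * Vᴴ = 1 := Matrix.mem_unitaryGroup_iff.1 hV
    obtain ⟨C', hC'⟩ := exists_eq_consBlock (Vᴴ * C * U) c
      (by rw [← Matrix.mulVec_mulVec, ← Matrix.mulVec_mulVec, h1, Matrix.mulVec_smul,
            Matrix.mulVec_mulVec, hV1, Matrix.one_mulVec])
      (by rw [Matrix.conjTranspose_mul, Matrix.conjTranspose_mul,
            Matrix.conjTranspose_conjTranspose, ← Matrix.mulVec_mulVec, ← Matrix.mulVec_mulVec, h2,
            Matrix.mulVec_smul,
            Matrix.mulVec_mulVec, hU1, Matrix.one_mulVec])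
    obtain ⟨D', hD'⟩ := exists_eq_consBlock (Uᴴ * D * V) d
      (by rw [← Matrix.mulVec_mulVec, ← Matrix.mulVec_mulVec, h3, Matrix.mulVec_smul,
            Matrix.mulVec_mulVec, hU1, Matrix.one_mulVec])
      (by rw [Matrix.conjTranspose_mul, Matrix.conjTranspose_mul,
            Matrix.conjTranspose_conjTranspose, ← Matrix.mulVec_mulVec, ← Matrix.mulVec_mulVec, h4,
            Matrix.mulVec_smul,
            Matrix.mulVec_mulVec, hV1, Matrix.one_mulVec])
    have hC : C = V * consBlock c C' * Uᴴ := by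
      rw [← hC']
      calc C = (V * Vᴴ) * C * (U * Uᴴ) := by rw [hU2, hV2]; simp
        _ = _ := by simp only [Matrix.mul_assoc]
    have hD : D = U * consBlock d D' * Vᴴ := by
      rw [← hD']
      calc D = (U * Uᴴ) * D * (V * Vᴴ) := by rw [hU2, hV2]; simp
        _ = _ := by simp only [Matrix.mul_assoc]
    have conj_normal : ∀ {a : ℕ} {X M : Matrix (Fin a) (Fin a) ℂ}, X * Xᴴ = 1 →
        IsStarNormal M → IsStarNormal (Xᴴ * M * X) := fun {a X M} hX hM => by
      have hM' : Mᴴ * M = M * Mᴴ := hM.star_comm_self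
      refine ⟨?_⟩
      change (Xᴴ * M * X)ᴴ * (Xᴴ * M * X) = (Xᴴ * M * X) * (Xᴴ * M * X)ᴴ
      calc (Xᴴ * M * X)ᴴ * (Xᴴ * M * X) = Xᴴ * Mᴴ * (X * Xᴴ) * M * X := by
            simp [Matrix.conjTranspose_mul, Matrix.mul_assoc]
        _ = Xᴴ * (Mᴴ * M) * X := by rw [hX]; simp [Matrix.mul_assoc]
        _ = Xᴴ * M * (X * Xᴴ) * Mᴴ * X := by rw [hX, hM']; simp [Matrix.mul_assoc]
        _ = _ := by simp [Matrix.conjTranspose_mul, Matrix.mul_assoc]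
    have e1 : consBlock (c * d) (C' * D') = Vᴴ * (C * D) * V := by
      rw [← consBlock_mul, ← hC', ← hD']
      calc Vᴴ * C * U * (Uᴴ * D * V) = Vᴴ * C * (U * Uᴴ) * D * V := by
            simp only [Matrix.mul_assoc]
        _ = _ := by rw [hU2]; simp [Matrix.mul_assoc]
    have e2 : consBlock (d * c) (D' * C') = Uᴴ * (D * C) * U := by
      rw [← consBlock_mul, ← hC', ← hD']
      calc Uᴴ * D * V * (Vᴴ * C * U) = Uᴴ * D * (V * Vᴴ) * C * U := by
            simp only [Matrix.mul_assoc]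
        _ = _ := by rw [hV2]; simp [Matrix.mul_assoc]
    obtain ⟨U', hU', V', hV', c', d', rfl, rfl⟩ := ih s C' D'
      (isStarNormal_of_consBlock (e1 ▸ conj_normal hV2 hCD))
      (isStarNormal_of_consBlock (e2 ▸ conj_normal hU2 hDC))
    refine ⟨U * consBlock 1 U', mul_mem hU (consBlock_mem_unitaryGroup hU'),
      V * consBlock 1 V', mul_mem hV (consBlock_mem_unitaryGroup hV'),
      fun n => Nat.casesOn n c c', fun n => Nat.casesOn n d d', ?_, ?_⟩
    · rw [hC, ← consBlock_seqDiag, Matrix.conjTranspose_mul, consBlock_conjTranspose]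
      calc V * consBlock c (V' * seqDiag r s c' * U'ᴴ) * Uᴴ
          = V * (consBlock 1 V' * consBlock c (seqDiag r s c') * consBlock (star 1) U'ᴴ) * Uᴴ := by
            simp only [consBlock_mul, star_one, one_mul, mul_one]
        _ = _ := by simp only [Matrix.mul_assoc]
    · rw [hD, ← consBlock_seqDiag, Matrix.conjTranspose_mul, consBlock_conjTranspose]
      calc U * consBlock d (U' * seqDiag s r d' * V'ᴴ) * Vᴴ
          = U * (consBlock 1 U' * consBlock d (seqDiag s r d') * consBlock (star 1) V'ᴴ) * Vᴴ := by
            simp only [consBlock_mul, star_one, one_mul, mul_one]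
        _ = _ := by simp only [Matrix.mul_assoc]

theorem exists_jointLabelling (r s : ℕ) (C : Matrix (Fin r) (Fin s) ℂ)
    (D : Matrix (Fin s) (Fin r) ℂ) (hCD : IsStarNormal (C * D)) (hDC : IsStarNormal (D * C)) :
    ∃ (σ δ : Fin (min r s) → ℝ) (z : Fin (min r s) → ℂ), JointLabelling C D σ δ z := by
  have diag_eq : ∀ (m k : ℕ) (c : ℕ → ℂ), min m k = min r s →
      seqDiag m k c = rectDiag m k (fun j : Fin (min r s) => c j) := fun m k c h => by
    ext i j
    have := i.2
    have := j.2
    simp only [seqDiag, rectDiag, Matrix.of_apply]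
    split_ifs <;> first | rfl | omega
  obtain ⟨U, hU, V, hV, c, d, hC, hD⟩ := exists_joint_svd r s C D hCD hDC
  rw [diag_eq r s c rfl] at hC
  rw [diag_eq s r d (min_comm _ _)] at hD
  exact ⟨_, _, _, U, hU, V, hV, _, _, hC, hD, fun j => ⟨rfl, rfl, rfl⟩⟩

/-! ### Pseudo-convexity of the Krein space numerical range -/

section PseudoConvex

variable {n : Type*} [Fintype n]

theorem ip_add_left (J : Matrix n n ℂ) (x y z : n → ℂ) :
    ip J (x + y) z = ip J x z + ip J y z := by
  simp [ip, Matrix.mulVec_add]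

theorem ip_add_right (J : Matrix n n ℂ) (x y z : n → ℂ) :
    ip J x (y + z) = ip J x y + ip J x z := by
  simp [ip, add_dotProduct]

theorem ip_smul_left (J : Matrix n n ℂ) (a : ℂ) (x y : n → ℂ) :
    ip J (a • x) y = a * ip J x y := by
  simp [ip, Matrix.mulVec_smul]

theorem ip_smul_right (J : Matrix n n ℂ) (a : ℂ) (x y : n → ℂ) :
    ip J x (a • y) = star a * ip J x y := by
  simp [ip]

theorem ip_neg_matrix (J : Matrix n n ℂ) (x y : n → ℂ) : ip (-J) x y = -ip J x y := by
  simp [ip, Matrix.neg_mulVec]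

theorem star_ip {J : Matrix n n ℂ} (hJ : J.IsHermitian) (x y : n → ℂ) :
    star (ip J x y) = ip J y x := by
  rw [ip, ip, ← Matrix.star_dotProduct_star, star_star, Matrix.star_mulVec, hJ.eq,
    ← Matrix.dotProduct_mulVec]

theorem ip_self_eq_ofReal {J : Matrix n n ℂ} (hJ : J.IsHermitian) (x : n → ℂ) :
    ip J x x = ((ip J x x).re : ℂ) :=
  (Complex.conj_eq_iff_re.1 (star_ip hJ x x)).symm

theorem rangePos_neg (J A : Matrix n n ℂ) : rangePos (-J) A = negRangeNeg J A := by
  ext w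
  simp [rangePos, negRangeNeg, ip_neg_matrix, neg_eq_iff_eq_neg]

theorem negRangeNeg_neg (J A : Matrix n n ℂ) : negRangeNeg (-J) A = rangePos J A := by
  rw [← rangePos_neg, neg_neg]

/-- Points of `W_+` may be read off vectors that are positive but not normalised. -/
theorem mem_rangePos_of_pos {J : Matrix n n ℂ} (hJ : J.IsHermitian) (A : Matrix n n ℂ) {w : ℂ}
    (x : n → ℂ) (hx : 0 < (ip J x x).re) (hw : ip J (A *ᵥ x) x = w * ip J x x) :
    w ∈ rangePos J A := by
  set N := (ip J x x).re with hN
  have hNx : ip J x x = (N : ℂ) := ip_self_eq_ofReal hJ x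
  have hs : ((√N : ℝ) : ℂ) ≠ 0 := by exact_mod_cast (Real.sqrt_pos.2 hx).ne'
  have hss : (N : ℂ) = ((√N : ℝ) : ℂ) * (√N : ℝ) := by
    exact_mod_cast (Real.mul_self_sqrt hx.le).symm
  refine ⟨((√N : ℝ) : ℂ)⁻¹ • x, ?_, ?_⟩
  · rw [ip_smul_left, ip_smul_right, hNx, hss]
    simp only [star_inv₀, Complex.star_def, Complex.conj_ofReal]
    field_simp
  · rw [Matrix.mulVec_smul, ip_smul_left, ip_smul_right, hw, hNx, hss]
    simp only [star_inv₀, Complex.star_def, Complex.conj_ofReal]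
    field_simp

/-- A real quadratic whose leading and constant coefficients have opposite signs has roots of both
signs; the sign of `s` selects one of them. -/
theorem exists_root_of_sign (p k r s : ℝ) (hp : 0 < p) (hr : 0 ≤ r) :
    ∃ b : ℝ, p * b ^ 2 + k * b = r ∧ 0 ≤ b * s := by
  set d := √(k ^ 2 + 4 * p * r) with hd
  have hd2 : d ^ 2 = k ^ 2 + 4 * p * r := Real.sq_sqrt (by positivity)
  have hkd : |k| ≤ d := Real.abs_le_sqrt (by nlinarith [mul_nonneg hp.le hr])
  obtain ⟨h1, h2⟩ := abs_le.1 hkd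
  have root : ∀ e : ℝ, e ^ 2 = d ^ 2 →
      p * ((-k + e) / (2 * p)) ^ 2 + k * ((-k + e) / (2 * p)) = r := fun e he => by
    rw [hd2] at he
    field_simp
    nlinarith
  rcases le_total 0 s with hs | hs
  · exact ⟨(-k + d) / (2 * p), root d rfl, mul_nonneg (div_nonneg (by linarith) (by linarith)) hs⟩
  · exact ⟨(-k + -d) / (2 * p), root (-d) (by ring),
      mul_nonneg_of_nonpos_of_nonpos
        (div_nonpos_of_nonpos_of_nonneg (by linarith) (by linarith)) hs⟩

theorem exists_phase_im_eq_zero (P Q : ℂ) :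
    ∃ o : ℂ, star o * o = 1 ∧ (star o * P + o * Q).im = 0 := by
  -- the imaginary part is that of `o * (Q - star P)`
  have him : ∀ o : ℂ, (star o * P + o * Q).im = (o * (Q - star P)).im := fun o => by
    simp; ring
  by_cases hR : Q - star P = 0
  · exact ⟨1, by simp, by rw [him, hR]; simp⟩
  set R := Q - star P
  have hn : (‖R‖ : ℂ) ≠ 0 := by exact_mod_cast norm_ne_zero_iff.2 hR
  have hRR : star R * R = (‖R‖ : ℂ) ^ 2 := Complex.conj_mul' R
  refine ⟨star R / ‖R‖, ?_, ?_⟩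
  · rw [star_div₀, star_star]
    simp only [Complex.star_def, Complex.conj_ofReal] at hRR ⊢
    field_simp
    rw [mul_comm, hRR]
  · rw [him, div_mul_eq_mul_div, hRR, pow_two, mul_div_assoc, div_self hn, mul_one,
      Complex.ofReal_im]

/-- The common core of the segment rule (`ε = 1`) and of the half-line rule (`ε = -1`): on the
two-dimensional space spanned by the two given vectors, the phase of the second coefficient is
chosen to make the equation for its modulus real. That equation then has roots of both signs, and
one of them gives a positive vector. -/
theorem exists_pos_vector {J : Matrix n n ℂ} (hJ : J.IsHermitian) (A : Matrix n n ℂ)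
    {x y : n → ℂ} {w₁ w₂ : ℂ} {ε t : ℝ} (hx : ip J x x = 1) (hy : ip J y y = ε)
    (hw₁ : ip J (A *ᵥ x) x = w₁) (hw₂ : ip J (A *ᵥ y) y = ε * w₂) (hne : w₁ ≠ w₂)
    (ht : ε = 1 ∧ 0 < t ∧ t < 1 ∨ ε = -1 ∧ 1 < t) :
    ∃ v, 0 < (ip J v v).re ∧ ip J (A *ᵥ v) v = (t * w₁ + (1 - t) * w₂) * ip J v v := by
  set w := t * w₁ + (1 - t) * w₂ with hw
  have hδ : w₁ - w₂ ≠ 0 := sub_ne_zero.2 hne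
  obtain ⟨o, ho, him⟩ := exists_phase_im_eq_zero
    ((ip J (A *ᵥ x) y - w * ip J x y) / (w₁ - w₂)) ((ip J (A *ᵥ y) x - w * ip J y x) / (w₁ - w₂))
  set K := star o * ((ip J (A *ᵥ x) y - w * ip J x y) / (w₁ - w₂)) +
    o * ((ip J (A *ᵥ y) x - w * ip J y x) / (w₁ - w₂)) with hK
  have hKr : K = (K.re : ℂ) := Complex.ext rfl (by simpa using him)
  set m : ℝ := 2 * (o * ip J y x).re with hm
  have hmC : star o * ip J x y + o * ip J y x = (m : ℂ) := by
    rw [← star_ip hJ y x, ← star_mul', add_comm, Complex.star_def, Complex.add_conj, hm]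
  have expand : ∀ b : ℝ, ip J (x + ((b : ℂ) * o) • y) (x + ((b : ℂ) * o) • y)
      = ((1 + ε * b ^ 2 + b * m : ℝ) : ℂ) := fun b => by
    simp only [ip_add_left, ip_add_right, ip_smul_left, ip_smul_right, hx, hy, star_mul',
      Complex.star_def, Complex.conj_ofReal]
    simp only [Complex.star_def] at ho hmC
    push_cast
    linear_combination (b : ℂ) * hmC + (b : ℂ) ^ 2 * ε * ho
  have expandA : ∀ b : ℝ, ip J (A *ᵥ (x + ((b : ℂ) * o) • y)) (x + ((b : ℂ) * o) • y)
      - w * ip J (x + ((b : ℂ) * o) • y) (x + ((b : ℂ) * o) • y)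
      = (w₁ - w₂) * ((1 - t - t * ε * b ^ 2 + b * K.re : ℝ) : ℂ) := fun b => by
    have hK' : (w₁ - w₂) * (K.re : ℂ) = star o * (ip J (A *ᵥ x) y - w * ip J x y) +
        o * (ip J (A *ᵥ y) x - w * ip J y x) := by
      rw [← hKr, hK]; field_simp
    simp only [Matrix.mulVec_add, Matrix.mulVec_smul, ip_add_left, ip_add_right, ip_smul_left,
      ip_smul_right, hx, hy, hw₁, hw₂, star_mul', Complex.star_def, Complex.conj_ofReal]
    simp only [Complex.star_def] at ho hK'
    push_cast
    rw [hw] at hK' ⊢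
    linear_combination (-(b : ℂ)) * hK' + (b : ℂ) ^ 2 * ε * (w₂ - (t * w₁ + (1 - t) * w₂)) * ho
  suffices h : ∃ b : ℝ, 1 - t - t * ε * b ^ 2 + b * K.re = 0 ∧ 0 < 1 + ε * b ^ 2 + b * m by
    obtain ⟨b, hb, hpos⟩ := h
    refine ⟨x + ((b : ℂ) * o) • y, by rw [expand, Complex.ofReal_re]; exact hpos, ?_⟩
    have := expandA b
    rw [hb, Complex.ofReal_zero, mul_zero] at this
    exact sub_eq_zero.1 this
  rcases ht with ⟨rfl, h0, h1⟩ | ⟨rfl, h1⟩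
  · obtain ⟨b, hb, hs⟩ := exists_root_of_sign t (-K.re) (1 - t) m h0 (by linarith)
    exact ⟨b, by linarith, by nlinarith⟩
  · obtain ⟨b, hb, hs⟩ := exists_root_of_sign t K.re (t - 1) (K.re + t * m) (by linarith)
      (by linarith)
    refine ⟨b, by linarith, ?_⟩
    have : 0 < t * (1 + -1 * b ^ 2 + b * m) := by nlinarith
    exact pos_of_mul_pos_right this (by linarith)

theorem rangePos_segment {J : Matrix n n ℂ} (hJ : J.IsHermitian) (A : Matrix n n ℂ) {w₁ w₂ : ℂ}
    {t : ℝ} (h₁ : w₁ ∈ rangePos J A) (h₂ : w₂ ∈ rangePos J A) (h0 : 0 ≤ t) (h1 : t ≤ 1) :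
    t * w₁ + (1 - t) * w₂ ∈ rangePos J A := by
  rcases eq_or_lt_of_le h0 with rfl | h0
  · simpa using h₂
  rcases eq_or_lt_of_le h1 with rfl | h1
  · simpa using h₁
  by_cases hne : w₁ = w₂
  · subst hne; convert h₁ using 1; ring
  obtain ⟨x, hx, hxw⟩ := h₁
  obtain ⟨y, hy, hyw⟩ := h₂
  obtain ⟨v, hv, hvw⟩ := exists_pos_vector hJ A (ε := 1) hx (by simpa using hy) hxw.symm
    (by simpa using hyw.symm) hne (Or.inl ⟨rfl, h0, h1⟩)
  exact mem_rangePos_of_pos hJ A v hv hvw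

theorem rangePos_ray {J : Matrix n n ℂ} (hJ : J.IsHermitian) (A : Matrix n n ℂ) {w₁ w₂ : ℂ}
    {t : ℝ} (h₁ : w₁ ∈ rangePos J A) (h₂ : w₂ ∈ negRangeNeg J A) (h1 : 1 ≤ t) :
    t * w₁ + (1 - t) * w₂ ∈ rangePos J A := by
  rcases eq_or_lt_of_le h1 with rfl | h1
  · simpa using h₁
  by_cases hne : w₁ = w₂
  · subst hne; convert h₁ using 1; ring
  obtain ⟨x, hx, hxw⟩ := h₁
  obtain ⟨y, hy, hyw⟩ := h₂
  obtain ⟨v, hv, hvw⟩ := exists_pos_vector hJ A (ε := -1) hx (by simpa using hy) hxw.symm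
    (by simp [hyw]) hne (Or.inr ⟨rfl, h1⟩)
  exact mem_rangePos_of_pos hJ A v hv hvw

theorem signedHull_signed_subset {J : Matrix n n ℂ} (hJ : J.IsHermitian) (A : Matrix n n ℂ)
    (S : Set ℂ) {s : Bool} {w : ℂ} (h : SignedHull (signed J A S) s w) :
    w ∈ if s then rangePos J A else negRangeNeg J A := by
  induction h with
  | base s w hw => cases s <;> exact hw.2
  | segment s w₁ w₂ t _ _ h0 h1 ih₁ ih₂ =>
    cases s
    · simp only [Bool.false_eq_true, if_false, ← rangePos_neg] at *
      exact rangePos_segment hJ.neg A ih₁ ih₂ h0 h1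
    · exact rangePos_segment hJ A ih₁ ih₂ h0 h1
  | ray s w₁ w₂ t _ _ ht ih₁ ih₂ =>
    cases s
    · simp only [Bool.false_eq_true, if_false, Bool.not_false, if_true, ← rangePos_neg] at *
      exact rangePos_ray hJ.neg A ih₁ (by rwa [negRangeNeg_neg]) ht
    · exact rangePos_ray hJ A ih₁ ih₂ ht

theorem pseudoConvexHull_subset_numRange {J : Matrix n n ℂ} (hJ : J.IsHermitian)
    (A : Matrix n n ℂ) (S : Set ℂ) : pseudoConvexHull J A S ⊆ numRange J A := by
  rintro w ⟨s, h⟩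
  have := signedHull_signed_subset hJ A S h
  cases s
  · exact Or.inl this
  · exact Or.inr this

end PseudoConvex

/-! ### Reduction to diagonal off-diagonal blocks -/

section UnitaryInvariance

variable {n : Type*} [Fintype n] [DecidableEq n]

theorem ip_mulVec_mulVec {J W : Matrix n n ℂ} (hW : Wᴴ * W = 1) (hJ : J * W = W * J)
    (x y : n → ℂ) : ip J (W *ᵥ x) (W *ᵥ y) = ip J x y := by
  rw [ip, ip, Matrix.star_mulVec, ← Matrix.dotProduct_mulVec, Matrix.mulVec_mulVec,
    Matrix.mulVec_mulVec, Matrix.mul_assoc, hJ, ← Matrix.mul_assoc, hW, Matrix.one_mul]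

theorem rangePos_subset_unitary_conj {J A W : Matrix n n ℂ} (hW : Wᴴ * W = 1)
    (hJ : J * W = W * J) : rangePos J A ⊆ rangePos J (W * A * Wᴴ) := by
  rintro w ⟨x, hx, rfl⟩
  refine ⟨W *ᵥ x, by rw [ip_mulVec_mulVec hW hJ, hx], ?_⟩
  rw [Matrix.mulVec_mulVec, Matrix.mul_assoc, hW, Matrix.mul_one, ← Matrix.mulVec_mulVec,
    ip_mulVec_mulVec hW hJ]

theorem rangePos_unitary_conj {J A W : Matrix n n ℂ} (hW : Wᴴ * W = 1)
    (hW' : W * Wᴴ = 1) (hJ : J * W = W * J) : rangePos J (W * A * Wᴴ) = rangePos J A := by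
  refine Set.Subset.antisymm ?_ (rangePos_subset_unitary_conj hW hJ)
  have hJ' : J * Wᴴ = Wᴴ * J := by
    calc J * Wᴴ = Wᴴ * W * J * Wᴴ := by rw [hW, Matrix.one_mul]
      _ = Wᴴ * (J * W) * Wᴴ := by rw [hJ]; simp only [Matrix.mul_assoc]
      _ = Wᴴ * J * (W * Wᴴ) := by simp only [Matrix.mul_assoc]
      _ = _ := by rw [hW', Matrix.mul_one]
  have h := rangePos_subset_unitary_conj (J := J) (A := W * A * Wᴴ) (W := Wᴴ) (by simpa using hW')
    hJ'
  have e : Wᴴ * (W * A * Wᴴ) * Wᴴᴴ = A := by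
    calc Wᴴ * (W * A * Wᴴ) * Wᴴᴴ = (Wᴴ * W) * A * (Wᴴ * W) := by
          simp [Matrix.mul_assoc]
      _ = A := by rw [hW]; simp
  rwa [e] at h

theorem negRangeNeg_unitary_conj {J A W : Matrix n n ℂ} (hW : Wᴴ * W = 1)
    (hW' : W * Wᴴ = 1) (hJ : J * W = W * J) : negRangeNeg J (W * A * Wᴴ) = negRangeNeg J A := by
  rw [← rangePos_neg, ← rangePos_neg, rangePos_unitary_conj hW hW' (by simp [hJ])]

theorem linePoly_unitary_conj {J A W : Matrix n n ℂ} (hJs : J.IsHermitian)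
    (hW : W * Wᴴ = 1) (hJ : J * W = W * J) : linePoly J (W * A * Wᴴ) = linePoly J A := by
  have hJ' : Wᴴ * J = J * Wᴴ := by
    simpa [Matrix.conjTranspose_mul, hJs.eq] using congrArg Matrix.conjTranspose hJ
  have hadj : adj J (W * A * Wᴴ) = W * adj J A * Wᴴ := by
    rw [adj, adj, Matrix.conjTranspose_mul, Matrix.conjTranspose_mul,
      Matrix.conjTranspose_conjTranspose]
    calc J * (W * (Aᴴ * Wᴴ)) * J = (J * W) * Aᴴ * (Wᴴ * J) := by simp only [Matrix.mul_assoc]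
      _ = _ := by rw [hJ, hJ']; simp only [Matrix.mul_assoc]
  have hre : reJ J (W * A * Wᴴ) = W * reJ J A * Wᴴ := by
    rw [reJ, reJ, hadj, Matrix.mul_smul, Matrix.smul_mul, Matrix.mul_add, Matrix.add_mul]
  have him : imJ J (W * A * Wᴴ) = W * imJ J A * Wᴴ := by
    rw [imJ, imJ, hadj, Matrix.mul_smul, Matrix.smul_mul, Matrix.mul_sub, Matrix.sub_mul]
  have hWm : W.map (MvPolynomial.C (σ := Fin 3)) * Wᴴ.map (MvPolynomial.C (σ := Fin 3)) = 1 := by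
    rw [← Matrix.map_mul, hW, Matrix.map_one _ (map_zero _) (map_one _)]
  rw [linePoly, linePoly, hre, him, Matrix.map_mul, Matrix.map_mul, Matrix.map_mul, Matrix.map_mul]
  set M := (MvPolynomial.X 0 : MvPolynomial (Fin 3) ℂ) • (reJ J A).map MvPolynomial.C
      + (MvPolynomial.X 1 : MvPolynomial (Fin 3) ℂ) • (imJ J A).map MvPolynomial.C
      + (MvPolynomial.X 2 : MvPolynomial (Fin 3) ℂ) • (1 : Matrix n n (MvPolynomial (Fin 3) ℂ))
    with hM
  trans (W.map (MvPolynomial.C (σ := Fin 3)) * M * Wᴴ.map (MvPolynomial.C (σ := Fin 3))).det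
  · congr 1
    rw [hM]
    simp only [Matrix.mul_add, Matrix.add_mul, Matrix.mul_smul, Matrix.smul_mul, Matrix.mul_one,
      hWm]
  · rw [Matrix.det_mul_comm, ← Matrix.mul_assoc, Matrix.det_mul,
      Matrix.det_mul_comm (Matrix.map _ _), hWm, Matrix.det_one, one_mul]

end UnitaryInvariance

theorem isHermitian_inertia (r s : ℕ) : (inertia r s).IsHermitian := by
  simp [Matrix.IsHermitian, inertia, Matrix.fromBlocks_conjTranspose]

/-- A block-diagonal unitary change of basis commutes with `J` and diagonalises the two
off-diagonal blocks. -/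
theorem exists_unitary_conj_blockMatrix {r s : ℕ} (α β : ℂ) {C : Matrix (Fin r) (Fin s) ℂ}
    {D : Matrix (Fin s) (Fin r) ℂ} {σ δ : Fin (min r s) → ℝ} {z : Fin (min r s) → ℂ}
    (h : JointLabelling C D σ δ z) :
    ∃ (W : Matrix (Fin r ⊕ Fin s) (Fin r ⊕ Fin s) ℂ) (c d : ℕ → ℂ), Wᴴ * W = 1 ∧ W * Wᴴ = 1 ∧
      inertia r s * W = W * inertia r s ∧
      blockMatrix α β C D = W * blockMatrix α β (seqDiag r s c) (seqDiag s r d) * Wᴴ ∧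
      ∀ j : Fin (min r s), σ j = ‖c j‖ ∧ δ j = ‖d j‖ ∧ z j = d j * c j := by
  obtain ⟨U, hU, V, hV, c, d, hC, hD, hj⟩ := h
  have hU1 : Uᴴ * U = 1 := Matrix.mem_unitaryGroup_iff'.1 hU
  have hU2 : U * Uᴴ = 1 := Matrix.mem_unitaryGroup_iff.1 hU
  have hV1 : Vᴴ * V = 1 := Matrix.mem_unitaryGroup_iff'.1 hV
  have hV2 : V * Vᴴ = 1 := Matrix.mem_unitaryGroup_iff.1 hV
  have diag_eq : ∀ (m k : ℕ) (c : Fin (min r s) → ℂ), min m k = min r s →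
      rectDiag m k c = seqDiag m k (fun n => if h : n < min r s then c ⟨n, h⟩ else 0) :=
    fun m k c h => by
    ext i j
    simp only [seqDiag, rectDiag, Matrix.of_apply]
    split_ifs <;> rfl
  rw [diag_eq r s c rfl] at hC
  rw [diag_eq s r d (min_comm _ _)] at hD
  refine ⟨Matrix.fromBlocks V 0 0 U, fun n => if h : n < min r s then c ⟨n, h⟩ else 0,
    fun n => if h : n < min r s then d ⟨n, h⟩ else 0, ?_, ?_, ?_, ?_, fun j => ?_⟩
  · simp [Matrix.fromBlocks_conjTranspose, Matrix.fromBlocks_multiply, hV1, hU1]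
  · simp [Matrix.fromBlocks_conjTranspose, Matrix.fromBlocks_multiply, hV2, hU2]
  · simp [inertia, Matrix.fromBlocks_multiply]
  · simp [blockMatrix, Matrix.fromBlocks_conjTranspose, Matrix.fromBlocks_multiply, hV2, hU2,
      hC, hD]
  · have hlt : j.1 < min r s := j.2
    simpa only [hlt, dite_true] using hj j

/-! ### Factorisation of the line polynomial -/

theorem prod_range_ite_lt {R : Type*} [CommRing R] (r s : ℕ) (f : ℕ → R) (a : R) :
    ∏ i : Fin s, (if i.1 < r then f i else a)
      = (∏ i ∈ Finset.range (min r s), f i) * a ^ (s - r) := by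
  rw [Fin.prod_univ_eq_prod_range (fun i => if i < r then f i else a) s]
  rcases le_total s r with h | h
  · rw [min_eq_right h, Nat.sub_eq_zero_of_le h, pow_zero, mul_one]
    exact Finset.prod_congr rfl fun i hi => if_pos ((Finset.mem_range.1 hi).trans_le h)
  · rw [min_eq_left h, ← Finset.prod_range_mul_prod_Ico _ h]
    congr 1
    · exact Finset.prod_congr rfl fun i hi => if_pos (Finset.mem_range.1 hi)
    · rw [Finset.prod_congr rfl fun i hi => if_neg (not_lt.2 (Finset.mem_Ico.1 hi).1)]
      simp

theorem det_fromBlocks_seqDiag {R : Type*} [CommRing R] [IsDomain R] (r s : ℕ) (a b : R)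
    (ha : a ≠ 0) (g h : ℕ → R) :
    (Matrix.fromBlocks (a • 1) (seqDiag r s g) (seqDiag s r h) (b • 1)).det
      = (∏ j ∈ Finset.range (min r s), (a * b - g j * h j)) * a ^ (r - s) * b ^ (s - r) := by
  set M := Matrix.fromBlocks (a • 1) (seqDiag r s g) (seqDiag s r h) (b • 1) with hM
  -- clear the upper right block without dividing by `a`
  have h1 : M * Matrix.fromBlocks 1 (-seqDiag r s g) 0 (a • 1)
      = Matrix.fromBlocks (a • 1) 0 (seqDiag s r h)
        (Matrix.diagonal fun i : Fin s => if i.1 < r then a * b - g i * h i else a * b) := by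
    rw [hM, Matrix.fromBlocks_multiply]
    congr 1
    · simp
    · simp
    · simp
    · ext i j
      simp only [Matrix.mul_neg, Matrix.add_apply, Matrix.neg_apply, Matrix.mul_apply, seqDiag,
        Matrix.of_apply, Matrix.smul_apply, Matrix.one_apply, Matrix.diagonal_apply, smul_eq_mul,
        ite_mul, zero_mul, mul_ite, mul_zero, mul_one]
      rw [Finset.sum_eq_single j (by intro k _ hk; simp [hk]) (by simp)]
      by_cases hir : i.1 < r
      · rw [Finset.sum_eq_single (⟨i, hir⟩ : Fin r)]
        · by_cases hij : i = j
          · subst hij; simp [hir]; ring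
          · have : i.1 ≠ j.1 := fun h => hij (Fin.ext h)
            simp [hij, this]
        · intro k _ hk
          have : i.1 ≠ k.1 := fun h => hk (Fin.ext h.symm)
          simp [this]
        · simp
      · rw [Finset.sum_eq_zero]
        · by_cases hij : i = j
          · subst hij; simp [hir, mul_comm]
          · simp [hij]
        · intro k _
          have : i.1 ≠ k.1 := fun h => hir (h ▸ k.2)
          simp [this]
  have h2 := congrArg Matrix.det h1
  rw [Matrix.det_mul, Matrix.det_fromBlocks_zero₂₁, Matrix.det_fromBlocks_zero₁₂, Matrix.det_one,
    one_mul, Matrix.det_smul, Matrix.det_smul, Matrix.det_one, Matrix.det_one, mul_one, mul_one,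
    Matrix.det_diagonal, Fintype.card_fin, Fintype.card_fin,
    prod_range_ite_lt r s (fun i => a * b - g i * h i)] at h2
  refine mul_right_cancel₀ (pow_ne_zero s ha) (h2.trans ?_)
  rcases le_total s r with hsr | hsr
  · obtain ⟨k, rfl⟩ := Nat.exists_eq_add_of_le hsr
    simp only [Nat.add_sub_cancel_left, Nat.sub_eq_zero_of_le hsr]
    ring
  · obtain ⟨k, rfl⟩ := Nat.exists_eq_add_of_le hsr
    simp only [Nat.add_sub_cancel_left, Nat.sub_eq_zero_of_le hsr]
    ring

/-- The equation, in line coordinates, of the pencil of lines through the point `z`. -/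
def pointPoly (z : ℂ) : MvPolynomial (Fin 3) ℂ :=
  MvPolynomial.C (z.re : ℂ) * MvPolynomial.X 0 + MvPolynomial.C (z.im : ℂ) * MvPolynomial.X 1
    + MvPolynomial.X 2

/-- The equation, in line coordinates, of the conic with foci `g + p`, `g - p`: the product of the
signed distances of a tangent from the two foci is `-k`, up to normalisation. -/
def conicPoly (g p : ℂ) (k : ℝ) : MvPolynomial (Fin 3) ℂ :=
  pointPoly g ^ 2
    - (MvPolynomial.C (p.re : ℂ) * MvPolynomial.X 0
        + MvPolynomial.C (p.im : ℂ) * MvPolynomial.X 1) ^ 2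
    + MvPolynomial.C (k : ℂ) * (MvPolynomial.X 0 ^ 2 + MvPolynomial.X 1 ^ 2)

theorem pointPoly_ne_zero (z : ℂ) : pointPoly z ≠ 0 := fun h => by
  simpa [pointPoly] using congrArg (MvPolynomial.eval ![0, 0, 1]) h

theorem pointPoly_mul_sub (g e p c d : ℂ) (k : ℝ) (hp : p ^ 2 = e ^ 2 + d * c)
    (hk : 4 * k = 2 * ‖p‖ ^ 2 - 2 * ‖e‖ ^ 2 + ‖c‖ ^ 2 + ‖d‖ ^ 2) :
    pointPoly (g + e) * pointPoly (g - e)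
      - (MvPolynomial.X 0 * MvPolynomial.C ((c - star d) / 2)
          + MvPolynomial.X 1 * MvPolynomial.C ((c + star d) / (2 * Complex.I)))
        * (MvPolynomial.X 0 * MvPolynomial.C ((d - star c) / 2)
          + MvPolynomial.X 1 * MvPolynomial.C ((d + star c) / (2 * Complex.I)))
      = conicPoly g p k := by
  have hre := congrArg Complex.re hp
  have him := congrArg Complex.im hp
  simp only [← Complex.normSq_eq_norm_sq, Complex.normSq_apply] at hk
  simp only [pow_two, Complex.add_re, Complex.add_im, Complex.mul_re, Complex.mul_im] at hre him
  have h00 : ((g + e).re : ℂ) * (g - e).re - (c - star d) / 2 * ((d - star c) / 2)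
      = (g.re : ℂ) ^ 2 - (p.re : ℂ) ^ 2 + k := by
    apply Complex.ext
    · simp [pow_two]; linarith
    · simp [pow_two]; ring
  have h11 : ((g + e).im : ℂ) * (g - e).im
        - (c + star d) / (2 * Complex.I) * ((d + star c) / (2 * Complex.I))
      = (g.im : ℂ) ^ 2 - (p.im : ℂ) ^ 2 + k := by
    have : (c + star d) / (2 * Complex.I) * ((d + star c) / (2 * Complex.I))
        = -((c + star d) * (d + star c) / 4) := by
      field_simp; rw [Complex.I_sq]; ring
    rw [this]
    apply Complex.ext
    · simp [pow_two]; linarith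
    · simp [pow_two]; ring
  have h01 : ((g + e).re : ℂ) * (g - e).im + ((g + e).im : ℂ) * (g - e).re
        - ((c - star d) / 2 * ((d + star c) / (2 * Complex.I))
          + (c + star d) / (2 * Complex.I) * ((d - star c) / 2))
      = 2 * (g.re : ℂ) * g.im - 2 * (p.re : ℂ) * p.im := by
    have : (c - star d) / 2 * ((d + star c) / (2 * Complex.I))
          + (c + star d) / (2 * Complex.I) * ((d - star c) / 2)
        = -Complex.I * ((c - star d) * (d + star c) + (c + star d) * (d - star c)) / 4 := by
      field_simp; rw [Complex.I_sq]; ring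
    rw [this]
    apply Complex.ext
    · simp; linarith
    · simp; ring
  have h02 : ((g + e).re : ℂ) + (g - e).re = 2 * g.re := by
    push_cast [Complex.add_re, Complex.sub_re]; ring
  have h12 : ((g + e).im : ℂ) + (g - e).im = 2 * g.im := by
    push_cast [Complex.add_im, Complex.sub_im]; ring
  have C2 : (MvPolynomial.C (2 : ℂ) : MvPolynomial (Fin 3) ℂ) = 2 := map_ofNat _ 2
  have H00 := congrArg (MvPolynomial.C (σ := Fin 3)) h00
  have H11 := congrArg (MvPolynomial.C (σ := Fin 3)) h11
  have H01 := congrArg (MvPolynomial.C (σ := Fin 3)) h01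
  have H02 := congrArg (MvPolynomial.C (σ := Fin 3)) h02
  have H12 := congrArg (MvPolynomial.C (σ := Fin 3)) h12
  simp only [map_add (MvPolynomial.C (σ := Fin 3)), map_sub (MvPolynomial.C (σ := Fin 3)),
    map_mul (MvPolynomial.C (σ := Fin 3)), map_pow, C2] at H00 H11 H01 H02 H12
  simp only [pointPoly, conicPoly]
  generalize (MvPolynomial.C ((c - star d) / 2) : MvPolynomial (Fin 3) ℂ) = a1 at *
  linear_combination MvPolynomial.X 0 ^ 2 * H00 + MvPolynomial.X 1 ^ 2 * H11
    + MvPolynomial.X 0 * MvPolynomial.X 1 * H01 + MvPolynomial.X 0 * MvPolynomial.X 2 * H02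
    + MvPolynomial.X 1 * MvPolynomial.X 2 * H12

theorem linePoly_blockMatrix_seqDiag (r s : ℕ) (α β : ℂ) (c d : ℕ → ℂ) :
    linePoly (inertia r s) (blockMatrix α β (seqDiag r s c) (seqDiag s r d))
      = (∏ j ∈ Finset.range (min r s), (pointPoly α * pointPoly β
          - (MvPolynomial.X 0 * MvPolynomial.C ((c j - star (d j)) / 2)
            + MvPolynomial.X 1 * MvPolynomial.C ((c j + star (d j)) / (2 * Complex.I)))
          * (MvPolynomial.X 0 * MvPolynomial.C ((d j - star (c j)) / 2)
            + MvPolynomial.X 1 * MvPolynomial.C ((d j + star (c j)) / (2 * Complex.I)))))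
        * pointPoly α ^ (r - s) * pointPoly β ^ (s - r) := by
  have hstar : ∀ (m k : ℕ) (c : ℕ → ℂ), (seqDiag m k c)ᴴ = seqDiag k m (fun n => star (c n)) :=
    fun m k c => by
    ext i j
    by_cases h : i.1 = j.1 <;> simp [seqDiag, h, eq_comm]
  have hadj : adj (inertia r s) (blockMatrix α β (seqDiag r s c) (seqDiag s r d))
      = blockMatrix (star α) (star β) (-seqDiag r s fun n => star (d n))
          (-seqDiag s r fun n => star (c n)) := by
    simp [adj, inertia, blockMatrix, Matrix.fromBlocks_conjTranspose, Matrix.fromBlocks_multiply,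
      hstar]
  have hre : ∀ z : ℂ, (1 / 2 : ℂ) * (z + star z) = z.re := fun z => by
    rw [Complex.star_def, Complex.add_conj]; push_cast; ring
  have him : ∀ z : ℂ, (1 / (2 * Complex.I) : ℂ) * (z - star z) = z.im := fun z => by
    rw [Complex.star_def, Complex.sub_conj]; push_cast; field_simp
  rw [← det_fromBlocks_seqDiag r s _ _ (pointPoly_ne_zero α), linePoly]
  congr 1
  rw [reJ, imJ, hadj, blockMatrix, blockMatrix, Matrix.fromBlocks_add, sub_eq_add_neg,
    Matrix.fromBlocks_neg, Matrix.fromBlocks_add, Matrix.fromBlocks_smul, Matrix.fromBlocks_smul,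
    ← Matrix.fromBlocks_one, Matrix.fromBlocks_map, Matrix.fromBlocks_map, Matrix.fromBlocks_smul,
    Matrix.fromBlocks_smul, Matrix.fromBlocks_smul, Matrix.fromBlocks_add, Matrix.fromBlocks_add]
  congr 1
  · ext1 i j
    by_cases h : i = j
    · subst h
      have h1 := hre α
      have h2 := him α
      simp only [Matrix.add_apply, Matrix.smul_apply, Matrix.map_apply, Matrix.sub_apply,
        Matrix.one_apply_eq, smul_eq_mul, mul_one, ← sub_eq_add_neg, h1, h2, pointPoly]
      ring
    · simp [h]
  · ext1 i j
    by_cases h : i.1 = j.1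
    · simp only [Matrix.add_apply, Matrix.smul_apply, Matrix.map_apply, Matrix.sub_apply,
        seqDiag, Matrix.of_apply, if_pos h, smul_eq_mul, Matrix.zero_apply, mul_zero, add_zero,
        neg_neg, ← sub_eq_add_neg]
      congr 3 <;> ring
    · simp [seqDiag, h]
  · ext1 i j
    by_cases h : i.1 = j.1
    · simp only [Matrix.add_apply, Matrix.smul_apply, Matrix.map_apply, Matrix.sub_apply,
        seqDiag, Matrix.of_apply, if_pos h, smul_eq_mul, Matrix.zero_apply, mul_zero, add_zero,
        neg_neg, ← sub_eq_add_neg]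
      congr 3 <;> ring
    · simp [seqDiag, h]
  · ext1 i j
    by_cases h : i = j
    · subst h
      have h1 := hre β
      have h2 := him β
      simp only [Matrix.add_apply, Matrix.smul_apply, Matrix.map_apply, Matrix.sub_apply,
        Matrix.one_apply_eq, smul_eq_mul, mul_one, ← sub_eq_add_neg, h1, h2, pointPoly]
      ring
    · simp [h]

/-! ### Irreducibility of the factors -/

theorem exists_sum_of_isHomogeneous_one {q : MvPolynomial (Fin 3) ℂ} (hq : q.IsHomogeneous 1) :
    ∃ v : Fin 3 → ℂ, q = ∑ i, MvPolynomial.C (v i) * MvPolynomial.X i := by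
  have h : q ∈ MvPolynomial.homogeneousSubmodule (Fin 3) ℂ 1 := hq
  rw [MvPolynomial.homogeneousSubmodule_one_eq_span_X,
    Submodule.mem_span_range_iff_exists_fun] at h
  obtain ⟨v, rfl⟩ := h
  exact ⟨v, by simp [MvPolynomial.smul_eq_C_mul]⟩

/-- A nonsingular conic is irreducible: two linear factors would have a common zero, and there
the gradient of their product vanishes. -/
theorem irreducible_of_grad_ne_zero {q : MvPolynomial (Fin 3) ℂ} (hq : q.IsHomogeneous 2)
    (hq0 : q ≠ 0) (hgrad : ∀ Q, grad q Q = 0 → Q = 0) : Irreducible q := by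
  have hdeg : q.totalDegree = 2 := hq.totalDegree hq0
  constructor
  · intro hu
    have := (MvPolynomial.isUnit_iff_totalDegree_of_isReduced.1 hu).2
    omega
  intro a b hab
  have ha0 : a ≠ 0 := by rintro rfl; simp [hab] at hq0
  have hb0 : b ≠ 0 := by rintro rfl; simp [hab] at hq0
  have hsum : a.totalDegree + b.totalDegree = 2 := by
    rw [← MvPolynomial.totalDegree_mul_of_isDomain ha0 hb0, ← hab, hdeg]
  have unit_of : ∀ f : MvPolynomial (Fin 3) ℂ, f ≠ 0 → f.totalDegree = 0 → IsUnit f :=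
    fun f hf h => by
    rw [MvPolynomial.totalDegree_eq_zero_iff_eq_C] at h
    rw [h] at hf ⊢
    exact (IsUnit.mk0 _ fun h0 => hf (by rw [h0, map_zero])).map _
  by_contra hno
  rw [not_or] at hno
  have ha1 : a.totalDegree = 1 := by
    have h1 : a.totalDegree ≠ 0 := fun h => hno.1 (unit_of a ha0 h)
    have h2 : b.totalDegree ≠ 0 := fun h => hno.2 (unit_of b hb0 h)
    omega
  have hb1 : b.totalDegree = 1 := by omega
  -- only the linear parts of the two factors contribute in degree two
  have split : ∀ f : MvPolynomial (Fin 3) ℂ, f.totalDegree = 1 →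
      f = MvPolynomial.C (MvPolynomial.coeff 0 f) + MvPolynomial.homogeneousComponent 1 f :=
    fun f hf => by
    conv_lhs => rw [← MvPolynomial.sum_homogeneousComponent f, hf]
    simp [Finset.sum_range_succ]
  set a1 := MvPolynomial.homogeneousComponent 1 a with ha1def
  set b1 := MvPolynomial.homogeneousComponent 1 b with hb1def
  have ha1h : a1.IsHomogeneous 1 := MvPolynomial.homogeneousComponent_isHomogeneous 1 a
  have hb1h : b1.IsHomogeneous 1 := MvPolynomial.homogeneousComponent_isHomogeneous 1 b
  have hprod : q = a1 * b1 := by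
    have e : a * b = MvPolynomial.C (MvPolynomial.coeff 0 a * MvPolynomial.coeff 0 b)
        + MvPolynomial.C (MvPolynomial.coeff 0 a) * b1
        + MvPolynomial.C (MvPolynomial.coeff 0 b) * a1 + a1 * b1 := by
      conv_lhs => rw [split a ha1, split b hb1]
      rw [map_mul]; ring
    have h2 := congrArg (MvPolynomial.homogeneousComponent 2) (hab.trans e)
    rw [MvPolynomial.homogeneousComponent_eq_self hq, map_add, map_add, map_add,
      MvPolynomial.homogeneousComponent_C_mul, MvPolynomial.homogeneousComponent_C_mul,
      MvPolynomial.homogeneousComponent_of_mem ha1h, MvPolynomial.homogeneousComponent_of_mem hb1h,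
      MvPolynomial.homogeneousComponent_eq_self (ha1h.mul hb1h),
      MvPolynomial.homogeneousComponent_of_mem (MvPolynomial.isHomogeneous_C _ _)] at h2
    simpa using h2
  obtain ⟨v, hv⟩ := exists_sum_of_isHomogeneous_one ha1h
  obtain ⟨w, hw⟩ := exists_sum_of_isHomogeneous_one hb1h
  obtain ⟨Q, hQ0, hQ⟩ := (Matrix.exists_mulVec_eq_zero_iff (M := (Matrix.of ![v, w, 0]))).2
    (Matrix.det_eq_zero_of_row_eq_zero 2 fun j => by simp)
  have hQa : MvPolynomial.eval Q a1 = 0 := by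
    rw [hv]
    simpa [Matrix.mulVec, dotProduct] using congrFun hQ 0
  have hQb : MvPolynomial.eval Q b1 = 0 := by
    rw [hw]
    simpa [Matrix.mulVec, dotProduct] using congrFun hQ 1
  exact hQ0 (hgrad Q (by ext i; simp [grad, hprod, Derivation.leibniz, hQa, hQb]))

theorem isHomogeneous_pointPoly (z : ℂ) : (pointPoly z).IsHomogeneous 1 :=
  (((MvPolynomial.isHomogeneous_X _ _).C_mul _).add
    ((MvPolynomial.isHomogeneous_X _ _).C_mul _)).add (MvPolynomial.isHomogeneous_X _ _)

theorem isHomogeneous_conicPoly (g p : ℂ) (k : ℝ) : (conicPoly g p k).IsHomogeneous 2 := by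
  refine (((isHomogeneous_pointPoly g).pow 2).sub ((((MvPolynomial.isHomogeneous_X _ _).C_mul
    _).add ((MvPolynomial.isHomogeneous_X _ _).C_mul _)).pow 2)).add
    (MvPolynomial.IsHomogeneous.C_mul ?_ _)
  exact ((MvPolynomial.isHomogeneous_X _ _).pow 2).add ((MvPolynomial.isHomogeneous_X _ _).pow 2)

theorem irreducible_pointPoly (z : ℂ) : Irreducible (pointPoly z) := by
  refine MvPolynomial.irreducible_of_totalDegree_eq_one
    ((isHomogeneous_pointPoly z).totalDegree (pointPoly_ne_zero z)) fun x hx => ?_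
  refine IsUnit.mk0 x fun h0 => pointPoly_ne_zero z ?_
  ext i
  simpa [h0] using hx i

theorem eval_pointPoly (z : ℂ) (Q : Fin 3 → ℂ) :
    MvPolynomial.eval Q (pointPoly z) = z.re * Q 0 + z.im * Q 1 + Q 2 := by
  simp [pointPoly]

theorem grad_pointPoly (z : ℂ) (Q : Fin 3 → ℂ) :
    grad (pointPoly z) Q = ![(z.re : ℂ), (z.im : ℂ), 1] := by
  ext i
  fin_cases i <;> simp [grad, pointPoly, MvPolynomial.pderiv_X]

theorem eval_conicPoly (g p : ℂ) (k : ℝ) (Q : Fin 3 → ℂ) :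
    MvPolynomial.eval Q (conicPoly g p k) = (g.re * Q 0 + g.im * Q 1 + Q 2) ^ 2
      - (p.re * Q 0 + p.im * Q 1) ^ 2 + k * (Q 0 ^ 2 + Q 1 ^ 2) := by
  simp [conicPoly, eval_pointPoly]

theorem grad_conicPoly (g p : ℂ) (k : ℝ) (Q : Fin 3 → ℂ) :
    grad (conicPoly g p k) Q =
      ![2 * (g.re * (g.re * Q 0 + g.im * Q 1 + Q 2) - p.re * (p.re * Q 0 + p.im * Q 1) + k * Q 0),
        2 * (g.im * (g.re * Q 0 + g.im * Q 1 + Q 2) - p.im * (p.re * Q 0 + p.im * Q 1) + k * Q 1),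
        2 * (g.re * Q 0 + g.im * Q 1 + Q 2)] := by
  ext i
  fin_cases i <;>
    simp [grad, conicPoly, pointPoly, MvPolynomial.pderiv_X,
      Derivation.leibniz_pow] <;> ring

theorem irreducible_conicPoly (g p : ℂ) (k : ℝ) (hk : 0 < k) (hp : k < ‖p‖ ^ 2) :
    Irreducible (conicPoly g p k) := by
  refine irreducible_of_grad_ne_zero (isHomogeneous_conicPoly g p k) (fun h => ?_) fun Q hQ => ?_
  · simpa [eval_conicPoly] using congrArg (MvPolynomial.eval ![0, 0, 1]) h
  rw [grad_conicPoly] at hQ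
  have h0 := congrFun hQ 0
  have h1 := congrFun hQ 1
  have h2 := congrFun hQ 2
  simp only [Matrix.cons_val, Pi.zero_apply] at h0 h1 h2
  rw [← Complex.normSq_eq_norm_sq, Complex.normSq_apply] at hp
  have hk0 : (k : ℂ) ≠ 0 := by exact_mod_cast hk.ne'
  have hh0 : ((p.re : ℂ) * p.re + p.im * p.im - k) ≠ 0 := by exact_mod_cast (sub_pos.2 hp).ne'
  have hL : (g.re : ℂ) * Q 0 + g.im * Q 1 + Q 2 = 0 := by simpa using h2
  rw [hL] at h0 h1
  have hS : (p.re : ℂ) * Q 0 + p.im * Q 1 = 0 :=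
    (mul_eq_zero.1 (by linear_combination (-p.re : ℂ) / 2 * h0 - p.im / 2 * h1 :
      ((p.re : ℂ) * p.re + p.im * p.im - k) * (p.re * Q 0 + p.im * Q 1) = 0)).resolve_left hh0
  rw [hS] at h0 h1
  have hQ0 : Q 0 = 0 := by simpa [hk0] using h0
  have hQ1 : Q 1 = 0 := by simpa [hk0] using h1
  have hQ2 : Q 2 = 0 := by simpa [hQ0, hQ1] using hL
  ext i
  fin_cases i <;> assumption

/-! ### Dual curves -/

theorem realDual_pointPoly (z : ℂ) : realDual (pointPoly z) = {z} := by
  have hne : (![(z.re : ℂ), (z.im : ℂ), 1] : Fin 3 → ℂ) ≠ 0 := fun h => by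
    simpa using congrFun h 2
  ext w
  simp only [realDual, Set.mem_ofPred_eq, Set.mem_singleton_iff]
  constructor
  · intro h
    have h0 := h 1 (MvPolynomial.X 0 - MvPolynomial.C (z.re : ℂ) * MvPolynomial.X 2)
      ((MvPolynomial.isHomogeneous_X _ _).sub ((MvPolynomial.isHomogeneous_X _ _).C_mul _))
      (fun Q _ _ => by simp [grad_pointPoly])
    have h1 := h 1 (MvPolynomial.X 1 - MvPolynomial.C (z.im : ℂ) * MvPolynomial.X 2)
      ((MvPolynomial.isHomogeneous_X _ _).sub ((MvPolynomial.isHomogeneous_X _ _).C_mul _))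
      (fun Q _ _ => by simp [grad_pointPoly])
    simp [sub_eq_zero] at h0 h1
    exact Complex.ext h0 h1
  · rintro rfl d f _ hf
    have := hf 0 (by rw [eval_pointPoly]; simp) (by rw [grad_pointPoly]; exact hne)
    rwa [grad_pointPoly] at this

/-- Affine equation of the hyperbola with foci `g + p`, `g - p` and squared non-transverse
semi-axis `k`. -/
def HyperbolaEq (g p : ℂ) (k : ℝ) (z : ℂ) : Prop :=
  (p.re * (z - g).re + p.im * (z - g).im) ^ 2 - (‖p‖ ^ 2 - k) * ‖z - g‖ ^ 2 = (‖p‖ ^ 2 - k) * k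

theorem realDual_conicPoly (g p : ℂ) (k : ℝ) (hk : 0 < k) (hp : k < ‖p‖ ^ 2) :
    realDual (conicPoly g p k) = {z | HyperbolaEq g p k z} := by
  have hh : 0 < p.re * p.re + p.im * p.im - k := by
    rw [← Complex.normSq_eq_norm_sq, Complex.normSq_apply] at hp; linarith
  ext z
  simp only [realDual, HyperbolaEq, Set.mem_ofPred_eq, ← Complex.normSq_eq_norm_sq,
    Complex.normSq_apply, Complex.sub_re, Complex.sub_im]
  constructor
  · intro H
    set h : ℝ := p.re * p.re + p.im * p.im - k with hh'
    have e := H 2 ((MvPolynomial.C (p.re : ℂ) * (MvPolynomial.X 0 - MvPolynomial.C (g.re : ℂ) *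
          MvPolynomial.X 2) + MvPolynomial.C (p.im : ℂ) * (MvPolynomial.X 1 -
          MvPolynomial.C (g.im : ℂ) * MvPolynomial.X 2)) ^ 2
        - MvPolynomial.C (h : ℂ) * ((MvPolynomial.X 0 - MvPolynomial.C (g.re : ℂ) *
          MvPolynomial.X 2) ^ 2 + (MvPolynomial.X 1 - MvPolynomial.C (g.im : ℂ) *
          MvPolynomial.X 2) ^ 2)
        - MvPolynomial.C (h * k : ℂ) * MvPolynomial.X 2 ^ 2) ?_ ?_
    · simp only [map_sub, map_add, map_mul, map_pow, MvPolynomial.eval_C, MvPolynomial.eval_X,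
        Matrix.cons_val] at e
      have e' : ((p.re * (z.re - g.re) + p.im * (z.im - g.im)) ^ 2
          - h * ((z.re - g.re) * (z.re - g.re) + (z.im - g.im) * (z.im - g.im)) - h * k : ℝ)
          = (0 : ℂ) := by
        push_cast; linear_combination e
      have := Complex.ofReal_eq_zero.1 e'
      linarith
    · have lin : ∀ (i : Fin 3) (a : ℂ), (MvPolynomial.X i - MvPolynomial.C a * MvPolynomial.X 2 :
          MvPolynomial (Fin 3) ℂ).IsHomogeneous 1 := fun i a =>
        (MvPolynomial.isHomogeneous_X _ _).sub ((MvPolynomial.isHomogeneous_X _ _).C_mul _)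
      exact (((((lin _ _).C_mul _).add ((lin _ _).C_mul _)).pow 2).sub
        ((((lin _ _).pow 2).add ((lin _ _).pow 2)).C_mul _)).sub
          (((MvPolynomial.isHomogeneous_X _ _).pow 2).C_mul _)
    · intro Q hQ _
      rw [eval_conicPoly] at hQ
      have hhC : (h : ℂ) = p.re * p.re + p.im * p.im - k := by rw [hh']; push_cast; ring
      simp only [grad_conicPoly, map_sub, map_add, map_mul, map_pow, MvPolynomial.eval_C,
        MvPolynomial.eval_X, Matrix.cons_val, hhC]
      linear_combination (-4 * k * (p.re * p.re + p.im * p.im - k) : ℂ) * hQ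
  · intro hz d f _ hf
    set h : ℝ := p.re * p.re + p.im * p.im - k with hh'
    set s : ℝ := p.re * (z.re - g.re) + p.im * (z.im - g.im) with hs
    -- the tangent line at `z`, found by inverting the gradient
    have hh0 : h ≠ 0 := hh.ne'
    have hk0 : k ≠ 0 := hk.ne'
    set u : ℝ := s / h with hu
    have hsu : h * u = s := by rw [hu]; field_simp
    set a : ℝ := ((z.re - g.re) - p.re * u) / (2 * k) with ha
    set b : ℝ := ((z.im - g.im) - p.im * u) / (2 * k) with hb
    have hka : 2 * k * a = (z.re - g.re) - p.re * u := by rw [ha]; field_simp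
    have hkb : 2 * k * b = (z.im - g.im) - p.im * u := by rw [hb]; field_simp
    clear_value a b u s h
    have hS : p.re * a + p.im * b = -u / 2 := by
      have : k * (p.re * a + p.im * b) = k * (-u / 2) := by
        linear_combination p.re / 2 * hka + p.im / 2 * hkb - hs / 2 - hsu / 2 + u / 2 * hh'
      exact mul_left_cancel₀ hk0 this
    have hSC : (p.re : ℂ) * a + p.im * b = -u / 2 := by exact_mod_cast hS
    have hkaC : 2 * (k : ℂ) * a = (z.re - g.re) - p.re * u := by exact_mod_cast hka
    have hkbC : 2 * (k : ℂ) * b = (z.im - g.im) - p.im * u := by exact_mod_cast hkb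
    have hgr : grad (conicPoly g p k) ![(a : ℂ), b, 1 / 2 - g.re * a - g.im * b]
        = ![(z.re : ℂ), (z.im : ℂ), 1] := by
      rw [grad_conicPoly]
      simp only [Matrix.cons_val]
      rw [hSC]
      congr 1
      · linear_combination hkaC
      · congr 1
        · linear_combination hkbC
        · congr 1
          ring
    have := hf ![(a : ℂ), b, 1 / 2 - g.re * a - g.im * b] ?_ ?_
    · rwa [hgr] at this
    · rw [eval_conicPoly]
      simp only [Matrix.cons_val]
      rw [hSC]
      have e : (1 / 2 : ℝ) ^ 2 - (-u / 2) ^ 2 + k * (a ^ 2 + b ^ 2) = 0 := by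
        have e1 : (2 * k * a) ^ 2 + (2 * k * b) ^ 2
            = ((z.re - g.re) * (z.re - g.re) + (z.im - g.im) * (z.im - g.im)) - 2 * s * u
              + (h + k) * u ^ 2 := by
          rw [hka, hkb, show h + k = p.re * p.re + p.im * p.im by rw [hh']; ring, hs]
          ring
        have e2 : (z.re - g.re) * (z.re - g.re) + (z.im - g.im) * (z.im - g.im)
            = h * u ^ 2 - k := by
          apply mul_left_cancel₀ hh0
          linear_combination -hz - (h * u + s) * hsu
        rw [e2, ← hsu] at e1
        apply mul_left_cancel₀ hk0
        linear_combination e1 / 4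
      have eC : (((1 / 2 : ℝ) ^ 2 - (-u / 2) ^ 2 + k * (a ^ 2 + b ^ 2) : ℝ) : ℂ) = 0 := by
        exact_mod_cast e
      push_cast at eC
      linear_combination eC
    · rw [hgr]
      intro h0
      simpa using congrFun h0 2

theorem eval_smul_of_isHomogeneous {f : MvPolynomial (Fin 3) ℂ} {d : ℕ} (hf : f.IsHomogeneous d)
    (a : ℂ) (P : Fin 3 → ℂ) :
    MvPolynomial.eval (a • P) f = a ^ d * MvPolynomial.eval P f := by
  rw [MvPolynomial.eval_eq', MvPolynomial.eval_eq', Finset.mul_sum]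
  refine Finset.sum_congr rfl fun m hm => ?_
  have hdeg : ∑ i, m i = d := by
    simpa [Finsupp.weight_apply, Finsupp.sum_fintype] using hf (MvPolynomial.mem_support_iff.1 hm)
  simp only [Pi.smul_apply, smul_eq_mul, mul_pow, Finset.prod_mul_distrib,
    Finset.prod_pow_eq_pow_sum, hdeg]
  ring

theorem onDual_C_mul {a : ℂ} (ha : a ≠ 0) {q : MvPolynomial (Fin 3) ℂ} {P : Fin 3 → ℂ}
    (h : OnDual q P) : OnDual (MvPolynomial.C a * q) P := by
  intro d f hf H
  refine h d f hf fun Q hQ hg => ?_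
  have hgr : grad (MvPolynomial.C a * q) Q = a • grad q Q := by
    ext i; simp [grad, Derivation.leibniz]
  have h1 := H Q (by simp [hQ]) (by rw [hgr]; exact smul_ne_zero ha hg)
  rw [hgr, eval_smul_of_isHomogeneous hf] at h1
  exact (mul_eq_zero.1 h1).resolve_left (pow_ne_zero d ha)

theorem realDual_eq_of_associated {q q' : MvPolynomial (Fin 3) ℂ} (h : Associated q q') :
    realDual q = realDual q' := by
  have aux : ∀ {q q' : MvPolynomial (Fin 3) ℂ}, Associated q q' → realDual q ⊆ realDual q' := by
    rintro q _ ⟨u, rfl⟩ z hz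
    obtain ⟨a, ha, hau⟩ := MvPolynomial.isUnit_iff_eq_C_of_isReduced.1 u.isUnit
    rw [hau, mul_comm]
    exact onDual_C_mul ha.ne_zero hz
  exact Set.Subset.antisymm (aux h) (aux h.symm)

/-! ### Hyperbolas -/

theorem hyperbolaEq_iff_abs_dist_sub_dist (g p : ℂ) (k : ℝ) (hk : 0 < k) (hp : k < ‖p‖ ^ 2)
    (z : ℂ) :
    HyperbolaEq g p k z ↔ |dist z (g + p) - dist z (g - p)| = 2 * √(‖p‖ ^ 2 - k) := by
  set h := ‖p‖ ^ 2 - k with hh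
  have hh0 : 0 < h := sub_pos.2 hp
  set m := p.re * (z - g).re + p.im * (z - g).im with hm
  have hX : dist z (g + p) ^ 2 = ‖z - g‖ ^ 2 + ‖p‖ ^ 2 - 2 * m := by
    simp only [dist_eq_norm, ← Complex.normSq_eq_norm_sq, Complex.normSq_apply, hm, Complex.sub_re,
      Complex.sub_im, Complex.add_re, Complex.add_im]
    ring
  have hY : dist z (g - p) ^ 2 = ‖z - g‖ ^ 2 + ‖p‖ ^ 2 + 2 * m := by
    simp only [dist_eq_norm, ← Complex.normSq_eq_norm_sq, Complex.normSq_apply, hm, Complex.sub_re,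
      Complex.sub_im]
    ring
  have hcs : m ^ 2 ≤ ‖z - g‖ ^ 2 * ‖p‖ ^ 2 := by
    simp only [← Complex.normSq_eq_norm_sq, Complex.normSq_apply, hm]
    nlinarith [sq_nonneg (p.re * (z - g).im - p.im * (z - g).re)]
  have hX0 : 0 ≤ dist z (g + p) := dist_nonneg
  have hY0 : 0 ≤ dist z (g - p) := dist_nonneg
  have hE : HyperbolaEq g p k z ↔ m ^ 2 - h * ‖z - g‖ ^ 2 = h * k := Iff.rfl
  rw [hE]
  generalize dist z (g + p) = X at *
  generalize dist z (g - p) = Y at *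
  have habs : |X - Y| = 2 * √h ↔ (X - Y) ^ 2 = 4 * h := by
    rw [← sq_eq_sq₀ (abs_nonneg _) (by positivity), sq_abs, mul_pow, Real.sq_sqrt hh0.le]
    norm_num
  rw [habs]
  have hprod : (X * Y) ^ 2 = (‖z - g‖ ^ 2 + ‖p‖ ^ 2) ^ 2 - 4 * m ^ 2 := by
    rw [mul_pow, hX, hY]; ring
  have hpk : ‖p‖ ^ 2 = h + k := by rw [hh]; ring
  rw [hpk] at hX hY hprod hcs
  constructor
  · intro hm2
    have ht : h ≤ ‖z - g‖ ^ 2 := by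
      have : k * h ≤ k * ‖z - g‖ ^ 2 := by nlinarith
      exact le_of_mul_le_mul_left this hk
    have hXY : X * Y = ‖z - g‖ ^ 2 + k - h := by
      rw [← sq_eq_sq₀ (by positivity) (by linarith), hprod]
      linear_combination -4 * hm2
    linear_combination hX + hY - 2 * hXY
  · intro hXY
    have hXY' : X * Y = ‖z - g‖ ^ 2 + k - h := by linear_combination (hX + hY - hXY) / 2
    rw [hXY'] at hprod
    linear_combination hprod / 4

/-! ### The cone of a two-by-two block -/

/-- A vector orthogonal to a timelike vector is not timelike. -/
theorem not_timelike_of_orthogonal {t x y t' x' y' : ℝ} (h : t * t' = x * x' + y * y')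
    (h' : 0 < t' ^ 2 - x' ^ 2 - y' ^ 2) : t ^ 2 - x ^ 2 - y ^ 2 ≤ 0 := by
  by_contra! hlt
  have hcs : (x * x' + y * y') ^ 2 ≤ (x ^ 2 + y ^ 2) * (x' ^ 2 + y' ^ 2) := by
    nlinarith [sq_nonneg (x * y' - y * x')]
  rw [← h] at hcs
  have h0 : 0 < t ^ 2 := by nlinarith [sq_nonneg x, sq_nonneg y]
  have h1 : (t * t') ^ 2 ≤ t ^ 2 * (x' ^ 2 + y' ^ 2) :=
    hcs.trans (mul_le_mul_of_nonneg_right (by linarith) (by positivity))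
  nlinarith

/-- Two timelike vectors with positive Lorentz product have the same time orientation. -/
theorem pos_of_timelike {t x y t' x' y' : ℝ} (ht : 0 < t) (h : 0 < t ^ 2 - x ^ 2 - y ^ 2)
    (h' : 0 < t' ^ 2 - x' ^ 2 - y' ^ 2) (hp : 0 < t * t' - x * x' - y * y') : 0 < t' := by
  by_contra! hle
  have hcs : (x * x' + y * y') ^ 2 ≤ (x ^ 2 + y ^ 2) * (x' ^ 2 + y' ^ 2) := by
    nlinarith [sq_nonneg (x * y' - y * x')]
  have h1 : (x ^ 2 + y ^ 2) * (x' ^ 2 + y' ^ 2) ≤ t ^ 2 * t' ^ 2 :=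
    mul_le_mul (by linarith) (by linarith) (by positivity) (by positivity)
  have h2 : 0 ≤ -(t * t') := by nlinarith
  have h3 : -(t * t') < -(x * x' + y * y') := by linarith
  nlinarith

/-- The centred value of a two-by-two block at a vector `(a, b)`, as a function of
`T = |a|² + |b|²` and `ζ = conj a * b`. Since `T² - 4|ζ|²` is the square of `|a|² - |b|²`, vectors
of square `±1` give the parameters with `T² = 1 + 4|ζ|²`; others are allowed. -/
def blockVal (e c d : ℂ) (T : ℝ) (ζ : ℂ) : ℂ := T * e + c * ζ - d * star ζ

theorem blockVal_re (e c d : ℂ) (T : ℝ) (ζ : ℂ) : (blockVal e c d T ζ).re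
    = T * e.re + (c.re * ζ.re - c.im * ζ.im) - (d.re * ζ.re + d.im * ζ.im) := by
  simp [blockVal]

theorem blockVal_im (e c d : ℂ) (T : ℝ) (ζ : ℂ) : (blockVal e c d T ζ).im
    = T * e.im + (c.re * ζ.im + c.im * ζ.re) - (d.im * ζ.re - d.re * ζ.im) := by
  simp [blockVal]; ring

/-- The Lorentzian form `T² - 4|ζ|²` on the parameters `(T, ζ)`. -/
def lorentz (T : ℝ) (ζ : ℂ) : ℝ := T ^ 2 - (2 * ζ.re) ^ 2 - (2 * ζ.im) ^ 2

/-- The equation of the centred conic in line coordinates, as a real quadratic form. -/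
def dualForm (p : ℂ) (k : ℝ) (μ : ℂ) : ℝ :=
  (p.re * μ.re + p.im * μ.im) ^ 2 - k * (μ.re * μ.re + μ.im * μ.im)

/-- Half the gradient of `dualForm p k`: the pole of the line with coordinate `μ`. -/
def pole (p : ℂ) (k : ℝ) (μ : ℂ) : ℂ := ((p.re * μ.re + p.im * μ.im : ℝ) : ℂ) * p - k * μ

/-- The parameter `T` of the lift of `pole p k μ` to the cone. -/
def liftT (e μ : ℂ) : ℝ := e.re * μ.re + e.im * μ.im

/-- The parameter `ζ` of the lift of `pole p k μ` to the cone. -/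
def liftZ (c d μ : ℂ) : ℂ := (star μ * d - μ * star c) / 4

theorem pole_re (p : ℂ) (k : ℝ) (μ : ℂ) :
    (pole p k μ).re = (p.re * μ.re + p.im * μ.im) * p.re - k * μ.re := by
  simp [pole]

theorem pole_im (p : ℂ) (k : ℝ) (μ : ℂ) :
    (pole p k μ).im = (p.re * μ.re + p.im * μ.im) * p.im - k * μ.im := by
  simp [pole]

theorem liftZ_re (c d μ : ℂ) :
    (liftZ c d μ).re = ((d.re - c.re) * μ.re + (d.im - c.im) * μ.im) / 4 := by
  simp [liftZ]; ring

theorem liftZ_im (c d μ : ℂ) :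
    (liftZ c d μ).im = ((d.im + c.im) * μ.re - (d.re + c.re) * μ.im) / 4 := by
  simp [liftZ]; ring

/-- The lift of `pole p k μ` is orthogonal to the fibres of `blockVal`. -/
theorem lorentz_polar_lift (e c d : ℂ) (T : ℝ) (ζ μ : ℂ) :
    T * liftT e μ - 2 * ζ.re * (2 * (liftZ c d μ).re) - 2 * ζ.im * (2 * (liftZ c d μ).im)
      = μ.re * (blockVal e c d T ζ).re + μ.im * (blockVal e c d T ζ).im := by
  rw [blockVal_re, blockVal_im, liftZ_re, liftZ_im, liftT]
  ring

section Lift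

variable {e c d p : ℂ} {k : ℝ}

theorem blockVal_lift (hp : p ^ 2 = e ^ 2 + d * c)
    (hk4 : 4 * k = 2 * ‖p‖ ^ 2 - 2 * ‖e‖ ^ 2 + ‖c‖ ^ 2 + ‖d‖ ^ 2) (μ : ℂ) :
    blockVal e c d (liftT e μ) (liftZ c d μ) = pole p k μ := by
  have hre := congrArg Complex.re hp
  have him := congrArg Complex.im hp
  simp only [pow_two, Complex.add_re, Complex.add_im, Complex.mul_re, Complex.mul_im] at hre him
  simp only [← Complex.normSq_eq_norm_sq, Complex.normSq_apply] at hk4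
  apply Complex.ext
  · rw [blockVal_re, liftZ_re, liftZ_im, pole_re, liftT]
    linear_combination (-μ.re / 2) * hre - μ.im / 2 * him + μ.re / 4 * hk4
  · rw [blockVal_im, liftZ_re, liftZ_im, pole_im, liftT]
    linear_combination (μ.im / 2) * hre - μ.re / 2 * him + μ.im / 4 * hk4

theorem lorentz_lift (hp : p ^ 2 = e ^ 2 + d * c)
    (hk4 : 4 * k = 2 * ‖p‖ ^ 2 - 2 * ‖e‖ ^ 2 + ‖c‖ ^ 2 + ‖d‖ ^ 2) (μ : ℂ) :
    lorentz (liftT e μ) (liftZ c d μ) = dualForm p k μ := by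
  have h1 := lorentz_polar_lift e c d (liftT e μ) (liftZ c d μ) μ
  rw [blockVal_lift hp hk4, pole_re, pole_im] at h1
  rw [lorentz, dualForm]
  linear_combination h1

theorem hyperbolaEq_pole {μ : ℂ} (h : dualForm p k μ = 1) : HyperbolaEq 0 p k (pole p k μ) := by
  simp only [HyperbolaEq, sub_zero, ← Complex.normSq_eq_norm_sq, Complex.normSq_apply, pole_re,
    pole_im]
  rw [dualForm] at h
  linear_combination (p.re * p.re + p.im * p.im - k) * k * h

theorem eq_zero_of_pole_eq_zero (hk : 0 < k) (hpk : k < ‖p‖ ^ 2) {μ : ℂ} (h : pole p k μ = 0) :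
    μ = 0 := by
  rw [← Complex.normSq_eq_norm_sq, Complex.normSq_apply, ← sub_pos] at hpk
  have h1 := congrArg Complex.re h
  have h2 := congrArg Complex.im h
  rw [pole_re, Complex.zero_re] at h1
  rw [pole_im, Complex.zero_im] at h2
  have h3 : p.re * μ.re + p.im * μ.im = 0 := by
    apply mul_left_cancel₀ hpk.ne'
    linear_combination p.re * h1 + p.im * h2
  rw [h3] at h1 h2
  apply Complex.ext
  · simpa [hk.ne'] using h1
  · simpa [hk.ne'] using h2

theorem exists_pole_eq (hk : 0 < k) (hpk : k < ‖p‖ ^ 2) (w : ℂ) : ∃ μ, pole p k μ = w := by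
  rw [← Complex.normSq_eq_norm_sq, Complex.normSq_apply, ← sub_pos] at hpk
  obtain ⟨h, hh⟩ : ∃ h, h = p.re * p.re + p.im * p.im - k := ⟨_, rfl⟩
  rw [← hh] at hpk
  refine ⟨(((p.re * w.re + p.im * w.im : ℝ) : ℂ) * p - h * w) / ((h * k : ℝ) : ℂ), ?_⟩
  have hh0 := hpk.ne'
  have hk0 := hk.ne'
  apply Complex.ext
  · rw [pole_re, Complex.div_ofReal_re, Complex.div_ofReal_im]
    simp only [Complex.sub_re, Complex.sub_im, Complex.re_ofReal_mul, Complex.im_ofReal_mul]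
    field_simp
    linear_combination (-(p.re * w.re + p.im * w.im) * p.re) * hh
  · rw [pole_im, Complex.div_ofReal_re, Complex.div_ofReal_im]
    simp only [Complex.sub_re, Complex.sub_im, Complex.re_ofReal_mul, Complex.im_ofReal_mul]
    field_simp
    linear_combination (-(p.re * w.re + p.im * w.im) * p.im) * hh

theorem dualForm_line (p : ℂ) (k : ℝ) (μ η : ℂ) (t : ℝ) :
    dualForm p k (μ + t * η) = dualForm p k μ
      + 2 * ((p.re * μ.re + p.im * μ.im) * (p.re * η.re + p.im * η.im)
        - k * (μ.re * η.re + μ.im * η.im)) * t + dualForm p k η * t ^ 2 := by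
  simp only [dualForm, Complex.add_re, Complex.add_im, Complex.re_ofReal_mul,
    Complex.im_ofReal_mul]
  ring

theorem liftT_line (e μ η : ℂ) (t : ℝ) : liftT e (μ + t * η) = liftT e μ + t * liftT e η := by
  simp only [liftT, Complex.add_re, Complex.add_im, Complex.re_ofReal_mul, Complex.im_ofReal_mul]
  ring

theorem pole_line (p : ℂ) (k : ℝ) (μ η : ℂ) (t : ℝ) :
    pole p k (μ + t * η) = pole p k μ + t * pole p k η := by
  simp only [pole, Complex.add_re, Complex.add_im, Complex.re_ofReal_mul, Complex.im_ofReal_mul]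
  push_cast
  ring

/-- The lift of the coordinate `μ` of a point over the solid cone lies in the solid cone too: it
maximises the Lorentzian form on the fibre, because the fibres are not timelike. -/
theorem lift_mem_cone (hp : p ^ 2 = e ^ 2 + d * c)
    (hk4 : 4 * k = 2 * ‖p‖ ^ 2 - 2 * ‖e‖ ^ 2 + ‖c‖ ^ 2 + ‖d‖ ^ 2) (hk : 0 < k)
    (hpk : k < ‖p‖ ^ 2) {T : ℝ} {ζ μ : ℂ} (hT : 0 < T) (hTζ : 1 ≤ lorentz T ζ)
    (hμ : pole p k μ = blockVal e c d T ζ) : 0 < liftT e μ ∧ 1 ≤ dualForm p k μ := by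
  have hpolar : ∀ ν : ℂ,
      T * liftT e ν - 2 * ζ.re * (2 * (liftZ c d ν).re) - 2 * ζ.im * (2 * (liftZ c d ν).im)
      = liftT e μ * liftT e ν - 2 * (liftZ c d μ).re * (2 * (liftZ c d ν).re)
        - 2 * (liftZ c d μ).im * (2 * (liftZ c d ν).im) := fun ν => by
    rw [lorentz_polar_lift, lorentz_polar_lift, blockVal_lift hp hk4, hμ]
  have hLp : 0 < dualForm p k p := by
    rw [← Complex.normSq_eq_norm_sq, Complex.normSq_apply] at hpk
    have : dualForm p k p
        = (p.re * p.re + p.im * p.im) * (p.re * p.re + p.im * p.im - k) := by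
      simp only [dualForm]; ring
    rw [this]
    exact mul_pos (hk.trans hpk) (sub_pos.2 hpk)
  -- the difference of the two lifts is orthogonal to all lifts, in particular to the timelike
  -- lift of `pole p k p`
  have hdiff := not_timelike_of_orthogonal (t := T - liftT e μ)
    (x := 2 * ζ.re - 2 * (liftZ c d μ).re) (y := 2 * ζ.im - 2 * (liftZ c d μ).im)
    (t' := liftT e p) (x' := 2 * (liftZ c d p).re) (y' := 2 * (liftZ c d p).im)
    (by linear_combination hpolar p) (by rw [← lorentz, lorentz_lift hp hk4]; exact hLp)
  have h1 := hpolar μ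
  have h2 := lorentz_lift hp hk4 μ
  rw [lorentz] at h2 hTζ
  have hLμ : 1 ≤ dualForm p k μ := by linarith
  refine ⟨?_, hLμ⟩
  refine pos_of_timelike (x := 2 * ζ.re) (y := 2 * ζ.im) (x' := 2 * (liftZ c d μ).re)
    (y' := 2 * (liftZ c d μ).im) hT (by linarith) (by linarith) ?_
  rw [hpolar]
  linarith

/-- A nonzero direction along which the lift has constant `T` leads out of the cone. -/
theorem dualForm_neg_of_liftT_eq_zero (hp : p ^ 2 = e ^ 2 + d * c)
    (hk4 : 4 * k = 2 * ‖p‖ ^ 2 - 2 * ‖e‖ ^ 2 + ‖c‖ ^ 2 + ‖d‖ ^ 2) (hk : 0 < k)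
    (hpk : k < ‖p‖ ^ 2) {η : ℂ} (hη : η ≠ 0) (hT : liftT e η = 0) : dualForm p k η < 0 := by
  have h1 := lorentz_lift hp hk4 η
  rw [lorentz, hT] at h1
  have h2 := sq_nonneg (liftZ c d η).re
  have h3 := sq_nonneg (liftZ c d η).im
  refine lt_of_le_of_ne (by linarith) fun h0 => hη (eq_zero_of_pole_eq_zero hk hpk ?_)
  have hZ : liftZ c d η = 0 :=
    Complex.ext (pow_eq_zero_iff two_ne_zero |>.1 (by linarith))
      (pow_eq_zero_iff two_ne_zero |>.1 (by linarith))
  rw [← blockVal_lift hp hk4, hT, hZ]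
  simp [blockVal]

/-- Every point over the solid set `T² ≥ 1 + 4|ζ|²` lies on a segment between two points of the
hyperbola that come from the boundary of the cone: the coordinate `μ` of the point is moved in
both directions along the line on which `T` is constant, until `dualForm` drops to `1`. -/
theorem exists_hyperbola_segment (he : e ≠ 0) (hp : p ^ 2 = e ^ 2 + d * c)
    (hk4 : 4 * k = 2 * ‖p‖ ^ 2 - 2 * ‖e‖ ^ 2 + ‖c‖ ^ 2 + ‖d‖ ^ 2) (hk : 0 < k)
    (hpk : k < ‖p‖ ^ 2) {T : ℝ} {ζ : ℂ} (hT : 0 < T) (hTζ : 1 + 4 * ‖ζ‖ ^ 2 ≤ T ^ 2) :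
    ∃ (T' : ℝ) (ζ₁ ζ₂ : ℂ) (t : ℝ), 0 < T' ∧ 0 ≤ t ∧ t ≤ 1 ∧
      T' ^ 2 = 1 + 4 * ‖ζ₁‖ ^ 2 ∧ T' ^ 2 = 1 + 4 * ‖ζ₂‖ ^ 2 ∧
      HyperbolaEq 0 p k (blockVal e c d T' ζ₁) ∧ HyperbolaEq 0 p k (blockVal e c d T' ζ₂) ∧
      blockVal e c d T ζ = t * blockVal e c d T' ζ₁ + (1 - t) * blockVal e c d T' ζ₂ := by
  have hlor : ∀ (T : ℝ) (ζ : ℂ), lorentz T ζ = T ^ 2 - 4 * ‖ζ‖ ^ 2 := fun T ζ => by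
    rw [lorentz, ← Complex.normSq_eq_norm_sq, Complex.normSq_apply]; ring
  obtain ⟨μ, hμ⟩ := exists_pole_eq hk hpk (blockVal e c d T ζ)
  obtain ⟨hτμ, hLμ⟩ := lift_mem_cone hp hk4 hk hpk hT (by rw [hlor]; linarith) hμ
  have hη0 : Complex.I * e ≠ 0 := mul_ne_zero Complex.I_ne_zero he
  have hτη : liftT e (Complex.I * e) = 0 := by simp [liftT]; ring
  have hLη := dualForm_neg_of_liftT_eq_zero hp hk4 hk hpk hη0 hτη
  have hL := dualForm_line p k μ (Complex.I * e)
  generalize Complex.I * e = η at *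
  generalize (p.re * μ.re + p.im * μ.im) * (p.re * η.re + p.im * η.im)
    - k * (μ.re * η.re + μ.im * η.im) = B at hL
  obtain ⟨t₁, ht₁, h₁⟩ := exists_root_of_sign (-dualForm p k η) (-2 * B) (dualForm p k μ - 1) 1
    (by linarith) (by linarith)
  obtain ⟨t₂, ht₂, h₂⟩ := exists_root_of_sign (-dualForm p k η) (-2 * B) (dualForm p k μ - 1) (-1)
    (by linarith) (by linarith)
  have point : ∀ t : ℝ, -dualForm p k η * t ^ 2 + -2 * B * t = dualForm p k μ - 1 →
      liftT e μ ^ 2 = 1 + 4 * ‖liftZ c d (μ + t * η)‖ ^ 2 ∧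
      blockVal e c d (liftT e μ) (liftZ c d (μ + t * η)) = pole p k (μ + t * η) ∧
      HyperbolaEq 0 p k (pole p k (μ + t * η)) := fun t ht => by
    have hτ : liftT e (μ + t * η) = liftT e μ := by rw [liftT_line, hτη, mul_zero, add_zero]
    have hL1 : dualForm p k (μ + t * η) = 1 := by rw [hL]; linarith
    refine ⟨?_, by rw [← blockVal_lift hp hk4, hτ], hyperbolaEq_pole hL1⟩
    have := lorentz_lift hp hk4 (μ + t * η)
    rw [hτ, hL1, hlor] at this
    linarith
  obtain ⟨a₁, b₁, c₁⟩ := point t₁ ht₁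
  obtain ⟨a₂, b₂, c₂⟩ := point t₂ ht₂
  obtain ⟨t, ht0, ht1, ht⟩ : ∃ t : ℝ, 0 ≤ t ∧ t ≤ 1 ∧ t * t₁ + (1 - t) * t₂ = 0 := by
    have h0 : 0 ≤ t₁ := by linarith
    have h0' : t₂ ≤ 0 := by linarith
    rcases h0.eq_or_lt with h3 | h3
    · exact ⟨1, by norm_num, le_rfl, by rw [← h3]; ring⟩
    · have h4 : 0 < t₁ - t₂ := by linarith
      refine ⟨-t₂ / (t₁ - t₂), div_nonneg (by linarith) h4.le, ?_, ?_⟩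
      · rw [div_le_one h4]; linarith
      · field_simp; ring
  refine ⟨liftT e μ, _, _, t, hτμ, ht0, ht1, a₁, a₂, by rwa [b₁], by rwa [b₂], ?_⟩
  rw [b₁, b₂, pole_line, pole_line, hμ]
  have htC : (t : ℂ) * t₁ + (1 - t) * t₂ = 0 := by exact_mod_cast ht
  linear_combination -(pole p k η) * htC

end Lift

/-! ### Vectors as convex combinations of vectors of single blocks -/

/-- A value of the direct sum at a vector of sign `±1` is a convex combination, with weights
proportional to `‖ζ i‖`, of values of the blocks at vectors of the same sign. In particular
neutral components need no separate treatment. -/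
theorem sum_blockVal_mem_of_convex {ι : Type*} [Fintype ι] [Nonempty ι] {K : Set ℂ}
    (hK : Convex ℝ K) (e : ℂ) (c d : ι → ℂ)
    (hsolid : ∀ i (T : ℝ) (ζ : ℂ), 0 < T → 1 + 4 * ‖ζ‖ ^ 2 ≤ T ^ 2 →
      blockVal e (c i) (d i) T ζ ∈ K)
    {T : ℝ} (hT : 0 < T) (ζ : ι → ℂ) (hTζ : 1 + 4 * (∑ i, ‖ζ i‖) ^ 2 ≤ T ^ 2) :
    T * e + ∑ i, (c i * ζ i - d i * star (ζ i)) ∈ K := by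
  set R := ∑ i, ‖ζ i‖ with hR
  have hR0 : 0 ≤ R := Finset.sum_nonneg fun _ _ => norm_nonneg _
  rcases hR0.eq_or_lt with h0 | h0
  · have hz : ∀ i, ζ i = 0 := fun i => by
      have := (Finset.sum_eq_zero_iff_of_nonneg fun _ _ => norm_nonneg _).1 (hR ▸ h0.symm) i
        (Finset.mem_univ i)
      exact norm_eq_zero.1 this
    rw [← h0] at hTζ
    have := hsolid (Classical.arbitrary ι) T 0 hT (by simpa using hTζ)
    simpa [blockVal, hz] using this
  · have hRC : (R : ℂ) ≠ 0 := by exact_mod_cast h0.ne'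
    have hmem := hK.sum_mem (t := Finset.univ) (w := fun i => ‖ζ i‖ / R)
      (z := fun i => blockVal e (c i) (d i) T ((R / ‖ζ i‖ : ℝ) * ζ i))
      (fun i _ => by positivity)
      (by rw [← Finset.sum_div, ← hR, div_self h0.ne'])
      (fun i _ => hsolid i T _ hT (by
        refine le_trans ?_ hTζ
        have : ‖((R / ‖ζ i‖ : ℝ) : ℂ) * ζ i‖ ≤ R := by
          rw [norm_mul, Complex.norm_real, Real.norm_of_nonneg (by positivity)]
          by_cases hi : ‖ζ i‖ = 0
          · simpa [hi] using hR0
          · rw [div_mul_cancel₀ _ hi]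
        gcongr))
    convert hmem using 1
    have term : ∀ i, (‖ζ i‖ / R) • blockVal e (c i) (d i) T ((R / ‖ζ i‖ : ℝ) * ζ i)
        = ((‖ζ i‖ / R : ℝ) : ℂ) * (T * e) + (c i * ζ i - d i * star (ζ i)) := fun i => by
      rw [Complex.real_smul]
      by_cases hi : ζ i = 0
      · simp [hi]
      have hn : (‖ζ i‖ : ℂ) ≠ 0 := by exact_mod_cast norm_ne_zero_iff.2 hi
      simp only [blockVal, star_mul', Complex.star_def, Complex.conj_ofReal]
      push_cast
      field_simp
      ring
    rw [Finset.sum_congr rfl fun i _ => term i, Finset.sum_add_distrib, ← Finset.sum_mul,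
      ← Complex.ofReal_sum, ← Finset.sum_div, ← hR, div_self h0.ne', Complex.ofReal_one, one_mul]

theorem convex_signedHull (P : Bool → Set ℂ) (s : Bool) : Convex ℝ {w | SignedHull P s w} := by
  intro x hx y hy a b ha hb hab
  have := SignedHull.segment s x y a hx hy ha (by linarith)
  obtain rfl : b = 1 - a := by linarith
  simpa [Complex.real_smul] using this

/-! ### Values of the diagonalised block matrix -/

section Values

variable {r s : ℕ}

theorem sum_sum_ite_val_eq (f : Fin r → Fin s → ℂ) :
    ∑ i, ∑ j, (if i.1 = j.1 then f i j else 0)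
      = ∑ l : Fin (min r s), f (l.castLE (min_le_left r s)) (l.castLE (min_le_right r s)) := by
  rw [← Fintype.sum_prod_type', ← Finset.sum_filter]
  symm
  refine Finset.sum_bij (fun l _ => (l.castLE (min_le_left r s), l.castLE (min_le_right r s)))
    (fun l _ => by simp) (fun l _ l' _ h => ?_) (fun x hx => ?_) (fun l _ => rfl)
  · exact Fin.castLE_injective (min_le_left r s) (congrArg Prod.fst h)
  · obtain ⟨i, j⟩ := x
    have hij : i.1 = j.1 := by simpa using hx
    refine ⟨⟨i.1, lt_min i.2 (hij ▸ j.2)⟩, Finset.mem_univ _, ?_⟩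
    exact Prod.ext (Fin.ext rfl) (Fin.ext hij)

/-- The squared norm of the component of `x` in the positive subspace. -/
def posPart (x : Fin r ⊕ Fin s → ℂ) : ℝ := ∑ i, ‖x (Sum.inl i)‖ ^ 2

/-- The squared norm of the component of `x` in the negative subspace. -/
def negPart (x : Fin r ⊕ Fin s → ℂ) : ℝ := ∑ i, ‖x (Sum.inr i)‖ ^ 2

/-- The parameter `ζ` of the `l`-th two-dimensional component of `x`. -/
def crossTerm (x : Fin r ⊕ Fin s → ℂ) (l : Fin (min r s)) : ℂ :=
  star (x (Sum.inl (l.castLE (min_le_left r s)))) * x (Sum.inr (l.castLE (min_le_right r s)))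

theorem ip_inertia (x y : Fin r ⊕ Fin s → ℂ) :
    ip (inertia r s) x y = ∑ i, star (y (Sum.inl i)) * x (Sum.inl i)
      - ∑ i, star (y (Sum.inr i)) * x (Sum.inr i) := by
  simp [ip, inertia, dotProduct, Matrix.fromBlocks_mulVec, Fintype.sum_sum_type, Matrix.neg_mulVec,
    sub_eq_add_neg]

theorem star_mul_self_eq_norm_sq (z : ℂ) : star z * z = ((‖z‖ ^ 2 : ℝ) : ℂ) := by
  rw [Complex.star_def, Complex.conj_mul']; push_cast; rfl

theorem ip_inertia_self (x : Fin r ⊕ Fin s → ℂ) :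
    ip (inertia r s) x x = ((posPart x - negPart x : ℝ) : ℂ) := by
  simp only [ip_inertia, star_mul_self_eq_norm_sq, posPart, negPart]
  push_cast
  rfl

theorem ip_blockMatrix_seqDiag (g e : ℂ) (c d : ℕ → ℂ) (x : Fin r ⊕ Fin s → ℂ) :
    ip (inertia r s) (blockMatrix (g + e) (g - e) (seqDiag r s c) (seqDiag s r d) *ᵥ x) x
      = (posPart x - negPart x : ℝ) * g + ((posPart x + negPart x : ℝ) * e
        + ∑ l : Fin (min r s), (c l * crossTerm x l - d l * star (crossTerm x l))) := by
  have hl : ∀ i, (blockMatrix (g + e) (g - e) (seqDiag r s c) (seqDiag s r d) *ᵥ x) (Sum.inl i)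
      = (g + e) * x (Sum.inl i) + ∑ j : Fin s, (if i.1 = j.1 then c i * x (Sum.inr j) else 0) :=
    fun i => by
    simp [blockMatrix, seqDiag, Matrix.mulVec, dotProduct, Matrix.one_apply]
  have hr : ∀ j, (blockMatrix (g + e) (g - e) (seqDiag r s c) (seqDiag s r d) *ᵥ x) (Sum.inr j)
      = (g - e) * x (Sum.inr j) + ∑ i : Fin r, (if i.1 = j.1 then d i * x (Sum.inl i) else 0) :=
    fun j => by
    have : ∀ i : Fin r, (if j.1 = i.1 then d j * x (Sum.inl i) else 0)
        = if i.1 = j.1 then d i * x (Sum.inl i) else 0 := fun i => by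
      by_cases h : i.1 = j.1
      · rw [if_pos h, if_pos h.symm, h]
      · rw [if_neg h, if_neg fun h' => h h'.symm]
    simp [blockMatrix, seqDiag, Matrix.mulVec, dotProduct, Matrix.one_apply, this, add_comm]
  have h1 := sum_sum_ite_val_eq (fun (i : Fin r) (j : Fin s) =>
    star (x (Sum.inl i)) * (c i * x (Sum.inr j)))
  have h2 := sum_sum_ite_val_eq (fun (i : Fin r) (j : Fin s) =>
    star (x (Sum.inr j)) * (d i * x (Sum.inl i)))
  rw [Finset.sum_comm] at h2
  have e1 : ∑ i, star (x (Sum.inl i)) * ((g + e) * x (Sum.inl i)) = (g + e) * posPart x := by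
    rw [posPart, Complex.ofReal_sum, Finset.mul_sum]
    exact Finset.sum_congr rfl fun i _ => by rw [← star_mul_self_eq_norm_sq]; ring
  have e2 : ∑ i, star (x (Sum.inr i)) * ((g - e) * x (Sum.inr i)) = (g - e) * negPart x := by
    rw [negPart, Complex.ofReal_sum, Finset.mul_sum]
    exact Finset.sum_congr rfl fun i _ => by rw [← star_mul_self_eq_norm_sq]; ring
  simp only [ip_inertia, hl, hr, mul_add, Finset.sum_add_distrib, Finset.mul_sum, mul_ite, mul_zero,
    h1, h2, e1, e2, Finset.sum_sub_distrib]
  have e3 : ∑ l : Fin (min r s), star (x (Sum.inl (l.castLE (min_le_left r s)))) *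
      (c l * x (Sum.inr (l.castLE (min_le_right r s))))
        = ∑ l : Fin (min r s), c l * crossTerm x l :=
    Finset.sum_congr rfl fun l _ => by rw [crossTerm]; ring
  have e4 : ∑ l : Fin (min r s), star (x (Sum.inr (l.castLE (min_le_right r s)))) *
      (d l * x (Sum.inl (l.castLE (min_le_left r s))))
        = ∑ l : Fin (min r s), d l * star (crossTerm x l) :=
    Finset.sum_congr rfl fun l _ => by rw [crossTerm, star_mul', star_star]; ring
  simp only [Fin.val_castLE]
  rw [e3, e4]
  push_cast
  ring

theorem sum_norm_crossTerm_sq_le (x : Fin r ⊕ Fin s → ℂ) :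
    (∑ l, ‖crossTerm x l‖) ^ 2 ≤ posPart x * negPart x := by
  have sub : ∀ (m k : ℕ) (h : m ≤ k) (f : Fin k → ℝ), (∀ i, 0 ≤ f i) →
      ∑ l : Fin m, f (l.castLE h) ≤ ∑ i, f i := fun m k h f hf => by
    refine (Finset.sum_map Finset.univ (Fin.castLEEmb h) f).symm.trans_le ?_
    exact Finset.sum_le_sum_of_subset_of_nonneg (Finset.subset_univ _) fun i _ _ => hf i
  have hc : ∀ l, ‖crossTerm x l‖ = ‖x (Sum.inl (l.castLE (min_le_left r s)))‖
      * ‖x (Sum.inr (l.castLE (min_le_right r s)))‖ := fun l => by simp [crossTerm]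
  simp only [hc]
  refine (Finset.sum_mul_sq_le_sq_mul_sq _ _ _).trans ?_
  exact mul_le_mul
    (sub _ _ (min_le_left r s) (fun i => ‖x (Sum.inl i)‖ ^ 2) fun _ => by positivity)
    (sub _ _ (min_le_right r s) (fun i => ‖x (Sum.inr i)‖ ^ 2) fun _ => by positivity)
    (Finset.sum_nonneg fun _ _ => by positivity) (Finset.sum_nonneg fun _ _ => by positivity)

/-- The vector with components `a`, `b` in the `l`-th two-dimensional block. -/
def blockVec (l : Fin (min r s)) (a b : ℂ) : Fin r ⊕ Fin s → ℂ :=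
  Sum.elim (Pi.single (l.castLE (min_le_left r s)) a) (Pi.single (l.castLE (min_le_right r s)) b)

theorem posPart_blockVec (l : Fin (min r s)) (a b : ℂ) : posPart (blockVec l a b) = ‖a‖ ^ 2 := by
  rw [posPart, Finset.sum_eq_single (l.castLE (min_le_left r s))]
  · simp [blockVec]
  · intro i _ hi; simp [blockVec, hi]
  · simp

theorem negPart_blockVec (l : Fin (min r s)) (a b : ℂ) : negPart (blockVec l a b) = ‖b‖ ^ 2 := by
  rw [negPart, Finset.sum_eq_single (l.castLE (min_le_right r s))]
  · simp [blockVec]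
  · intro i _ hi; simp [blockVec, hi]
  · simp

theorem sum_crossTerm_blockVec (c d : ℕ → ℂ) (l : Fin (min r s)) (a b : ℂ) :
    ∑ i : Fin (min r s), (c i * crossTerm (blockVec l a b) i
        - d i * star (crossTerm (blockVec l a b) i))
      = c l * (star a * b) - d l * star (star a * b) := by
  rw [Finset.sum_eq_single l]
  · simp [blockVec, crossTerm]
  · intro i _ hi
    have : i.castLE (min_le_left r s) ≠ l.castLE (min_le_left r s) :=
      fun h => hi (Fin.castLE_injective (min_le_left r s) h)
    simp [blockVec, crossTerm, this]
  · simp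

/-- Boundary points of the cone come from vectors, in two ways: of square `1` or of square `-1`,
according to whether the larger component is the first or the second. -/
theorem exists_components {T : ℝ} {ζ : ℂ} (hT : 0 < T) (hTζ : T ^ 2 = 1 + 4 * ‖ζ‖ ^ 2) :
    (∃ a b : ℂ, star a * b = ζ ∧ ‖a‖ ^ 2 + ‖b‖ ^ 2 = T ∧ ‖a‖ ^ 2 - ‖b‖ ^ 2 = 1) ∧
    (∃ a b : ℂ, star a * b = ζ ∧ ‖a‖ ^ 2 + ‖b‖ ^ 2 = T ∧ ‖a‖ ^ 2 - ‖b‖ ^ 2 = -1) := by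
  set q := √((T + 1) / 2) with hq
  have hq2 : q ^ 2 = (T + 1) / 2 := Real.sq_sqrt (by linarith)
  have hq0 : 0 < q := Real.sqrt_pos.2 (by linarith)
  have hqC : (q : ℂ) ≠ 0 := by exact_mod_cast hq0.ne'
  have hn : ‖(q : ℂ)‖ ^ 2 = (T + 1) / 2 := by
    rw [Complex.norm_real, Real.norm_of_nonneg hq0.le, hq2]
  have hz : ‖ζ‖ ^ 2 / ((T + 1) / 2) = (T - 1) / 2 := by
    rw [div_eq_iff (by linarith)]; linarith
  constructor
  · refine ⟨q, ζ / q, ?_, ?_, ?_⟩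
    · simp only [Complex.star_def, Complex.conj_ofReal]; field_simp
    · rw [norm_div, div_pow, hn, hz]; ring
    · rw [norm_div, div_pow, hn, hz]; ring
  · refine ⟨star ζ / q, q, ?_, ?_, ?_⟩
    · simp only [Complex.star_def, map_div₀, Complex.conj_conj, Complex.conj_ofReal]; field_simp
    · rw [norm_div, norm_star, div_pow, hn, hz]; ring
    · rw [norm_div, norm_star, div_pow, hn, hz]; ring

theorem add_blockVal_mem_rangePos (g e : ℂ) (c d : ℕ → ℂ) (l : Fin (min r s)) {T : ℝ} {ζ : ℂ}
    (hT : 0 < T) (hTζ : T ^ 2 = 1 + 4 * ‖ζ‖ ^ 2) :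
    g + blockVal e (c l) (d l) T ζ ∈
      rangePos (inertia r s) (blockMatrix (g + e) (g - e) (seqDiag r s c) (seqDiag s r d)) := by
  obtain ⟨a, b, hab, hadd, hsub⟩ := (exists_components hT hTζ).1
  refine ⟨blockVec l a b, ?_, ?_⟩
  · rw [ip_inertia_self, posPart_blockVec, negPart_blockVec, hsub, Complex.ofReal_one]
  · rw [ip_blockMatrix_seqDiag, posPart_blockVec, negPart_blockVec, hsub, hadd,
      sum_crossTerm_blockVec, hab, blockVal, Complex.ofReal_one]
    ring

theorem sub_blockVal_mem_negRangeNeg (g e : ℂ) (c d : ℕ → ℂ) (l : Fin (min r s)) {T : ℝ} {ζ : ℂ}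
    (hT : 0 < T) (hTζ : T ^ 2 = 1 + 4 * ‖ζ‖ ^ 2) :
    g - blockVal e (c l) (d l) T ζ ∈
      negRangeNeg (inertia r s) (blockMatrix (g + e) (g - e) (seqDiag r s c) (seqDiag s r d)) := by
  obtain ⟨a, b, hab, hadd, hsub⟩ := (exists_components hT hTζ).2
  refine ⟨blockVec l a b, ?_, ?_⟩
  · rw [ip_inertia_self, posPart_blockVec, negPart_blockVec, hsub]; simp
  · rw [ip_blockMatrix_seqDiag, posPart_blockVec, negPart_blockVec, hsub, hadd,
      sum_crossTerm_blockVec, hab, blockVal]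
    push_cast
    ring

/-- The Cauchy-Schwarz inequality for a vector of square `1` or `-1`, in the form
`4 (∑ |ζ l|)² ≤ 4 |x₊|² |x₋|² = |x|⁴ - 1`. -/
theorem one_add_crossTerm_le {x : Fin r ⊕ Fin s → ℂ} (h : (posPart x - negPart x) ^ 2 = 1) :
    0 < posPart x + negPart x ∧
      1 + 4 * (∑ l, ‖crossTerm x l‖) ^ 2 ≤ (posPart x + negPart x) ^ 2 := by
  have h1 := sum_norm_crossTerm_sq_le x
  have hp : 0 ≤ posPart x := Finset.sum_nonneg fun _ _ => by positivity
  have hn : 0 ≤ negPart x := Finset.sum_nonneg fun _ _ => by positivity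
  refine ⟨lt_of_le_of_ne (by positivity) fun h0 => ?_, by nlinarith⟩
  have h2 : posPart x = 0 := by linarith
  have h3 : negPart x = 0 := by linarith
  simp [h2, h3] at h

end Values

/-! ### The curve and the numerical range -/

section Conics

variable {r s : ℕ} (g e : ℂ) (c d : ℕ → ℂ) (p : Fin (min r s) → ℂ) (k : Fin (min r s) → ℝ)

theorem numRange_eq_pseudoConvexHull (hmin : 0 < min r s) (he : e ≠ 0)
    (hp : ∀ j, p j ^ 2 = e ^ 2 + d j * c j)
    (hk4 : ∀ j, 4 * k j = 2 * ‖p j‖ ^ 2 - 2 * ‖e‖ ^ 2 + ‖c j‖ ^ 2 + ‖d j‖ ^ 2)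
    (hk : ∀ j, 0 < k j) (hpk : ∀ j, k j < ‖p j‖ ^ 2) :
    numRange (inertia r s) (blockMatrix (g + e) (g - e) (seqDiag r s c) (seqDiag s r d))
      = pseudoConvexHull (inertia r s)
          (blockMatrix (g + e) (g - e) (seqDiag r s c) (seqDiag s r d))
          (⋃ j, {z | HyperbolaEq g (p j) (k j) z}) := by
  refine Set.Subset.antisymm ?_ (pseudoConvexHull_subset_numRange (isHermitian_inertia r s) _ _)
  set A := blockMatrix (g + e) (g - e) (seqDiag r s c) (seqDiag s r d) with hA
  set S : Set ℂ := ⋃ j, {z | HyperbolaEq g (p j) (k j) z} with hS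
  have : Nonempty (Fin (min r s)) := ⟨⟨0, hmin⟩⟩
  -- a convex set that contains those points of the centred hyperbolas that come from the
  -- boundary of the cone contains all centred values at vectors of square `1` or `-1`
  have main : ∀ {K : Set ℂ}, Convex ℝ K → (∀ (j : Fin (min r s)) (T : ℝ) (ζ : ℂ), 0 < T →
        T ^ 2 = 1 + 4 * ‖ζ‖ ^ 2 → HyperbolaEq 0 (p j) (k j) (blockVal e (c j) (d j) T ζ) →
        blockVal e (c j) (d j) T ζ ∈ K) →
      ∀ x : Fin r ⊕ Fin s → ℂ, (posPart x - negPart x) ^ 2 = 1 →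
        ((posPart x + negPart x : ℝ) * e
          + ∑ l : Fin (min r s), (c l * crossTerm x l - d l * star (crossTerm x l))) ∈ K := by
    intro K hK hbase x hx
    obtain ⟨hT, hle⟩ := one_add_crossTerm_le hx
    refine sum_blockVal_mem_of_convex hK e (fun l : Fin (min r s) => c l) (fun l => d l) ?_ hT _ hle
    intro j T ζ hT hTζ
    obtain ⟨T', ζ₁, ζ₂, t, hT', ht0, ht1, h1, h2, hE1, hE2, heq⟩ :=
      exists_hyperbola_segment he (hp j) (hk4 j) (hk j) (hpk j) hT hTζ
    have := hK (hbase j T' ζ₁ hT' h1 hE1) (hbase j T' ζ₂ hT' h2 hE2) ht0 (sub_nonneg.2 ht1)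
      (by ring)
    rw [heq]
    simpa [Complex.real_smul] using this
  have shift : ∀ (j : Fin (min r s)) (w : ℂ), HyperbolaEq 0 (p j) (k j) w →
      g + w ∈ S ∧ g - w ∈ S := fun j w hw => by
    constructor <;> refine Set.mem_iUnion.2 ⟨j, ?_⟩
    · simpa [HyperbolaEq] using hw
    · have e1 : g - w - g = -w := by ring
      simp only [HyperbolaEq, sub_zero, Set.mem_ofPred_eq, e1, Complex.neg_re, Complex.neg_im,
        norm_neg] at hw ⊢
      linear_combination hw
  rintro w (⟨x, hx, rfl⟩ | ⟨x, hx, rfl⟩)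
  · refine ⟨false, ?_⟩
    rw [ip_inertia_self] at hx
    have hx' : posPart x - negPart x = -1 := by exact_mod_cast hx
    have hK : Convex ℝ {v : ℂ | SignedHull (signed (inertia r s) A S) false (g - v)} :=
      (convex_signedHull (signed (inertia r s) A S) false).affine_preimage
        (AffineMap.const ℝ ℂ g - AffineMap.id ℝ ℂ)
    have := main hK (fun j T ζ hT hTζ hE => SignedHull.base _ _
      ⟨(shift j _ hE).2, sub_blockVal_mem_negRangeNeg g e c d j hT hTζ⟩) x (by rw [hx']; norm_num)
    simp only [Set.mem_ofPred_eq] at this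
    rw [hA, ip_blockMatrix_seqDiag, hx']
    convert this using 1
    push_cast
    ring
  · refine ⟨true, ?_⟩
    rw [ip_inertia_self] at hx
    have hx' : posPart x - negPart x = 1 := by exact_mod_cast hx
    have hK : Convex ℝ {v : ℂ | SignedHull (signed (inertia r s) A S) true (g + v)} :=
      (convex_signedHull (signed (inertia r s) A S) true).affine_preimage
        (AffineMap.const ℝ ℂ g + AffineMap.id ℝ ℂ)
    have := main hK (fun j T ζ hT hTζ hE => SignedHull.base _ _
      ⟨(shift j _ hE).1, add_blockVal_mem_rangePos g e c d j hT hTζ⟩) x (by rw [hx']; norm_num)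
    simp only [Set.mem_ofPred_eq] at this
    rw [hA, ip_blockMatrix_seqDiag, hx']
    convert this using 1
    push_cast
    ring

theorem linePoly_eq_prod (hp : ∀ j, p j ^ 2 = e ^ 2 + d j * c j)
    (hk4 : ∀ j, 4 * k j = 2 * ‖p j‖ ^ 2 - 2 * ‖e‖ ^ 2 + ‖c j‖ ^ 2 + ‖d j‖ ^ 2) :
    linePoly (inertia r s) (blockMatrix (g + e) (g - e) (seqDiag r s c) (seqDiag s r d))
      = (∏ j, conicPoly g (p j) (k j)) * pointPoly (g + e) ^ (r - s)
        * pointPoly (g - e) ^ (s - r) := by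
  rw [linePoly_blockMatrix_seqDiag, Finset.prod_range]
  congr 2
  exact Finset.prod_congr rfl fun j _ =>
    pointPoly_mul_sub g e (p j) (c j) (d j) (k j) (hp j) (hk4 j)

theorem components_eq (hp : ∀ j, p j ^ 2 = e ^ 2 + d j * c j)
    (hk4 : ∀ j, 4 * k j = 2 * ‖p j‖ ^ 2 - 2 * ‖e‖ ^ 2 + ‖c j‖ ^ 2 + ‖d j‖ ^ 2)
    (hk : ∀ j, 0 < k j) (hpk : ∀ j, k j < ‖p j‖ ^ 2) :
    components (inertia r s) (blockMatrix (g + e) (g - e) (seqDiag r s c) (seqDiag s r d))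
      = Set.range (fun j => {z | HyperbolaEq g (p j) (k j) z}) ∪ {K | s < r ∧ K = {g + e}}
        ∪ {K | r < s ∧ K = {g - e}} := by
  have hirr : ∀ j, Irreducible (conicPoly g (p j) (k j)) := fun j =>
    irreducible_conicPoly g (p j) (k j) (hk j) (hpk j)
  have hdual : ∀ j, realDual (conicPoly g (p j) (k j)) = {z | HyperbolaEq g (p j) (k j) z} :=
    fun j => realDual_conicPoly g (p j) (k j) (hk j) (hpk j)
  have hpow : ∀ {q : MvPolynomial (Fin 3) ℂ} (z : ℂ) (n : ℕ), Irreducible q →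
      q ∣ pointPoly z ^ n → 0 < n ∧ realDual q = {z} := fun {q} z n hq hdvd => by
    refine ⟨Nat.pos_of_ne_zero fun h0 => hq.not_isUnit ?_, ?_⟩
    · rw [h0, pow_zero] at hdvd
      exact isUnit_of_dvd_one hdvd
    · rw [realDual_eq_of_associated (hq.associated_of_dvd (irreducible_pointPoly z)
        (hq.prime.dvd_of_dvd_pow hdvd)), realDual_pointPoly]
  ext K
  simp only [components, Set.mem_ofPred_eq, Set.mem_union, Set.mem_range,
    linePoly_eq_prod g e c d p k hp hk4]
  constructor
  · rintro ⟨q, hq, hdvd, rfl⟩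
    rcases hq.prime.dvd_or_dvd hdvd with hdvd | hdvd
    · rcases hq.prime.dvd_or_dvd hdvd with hdvd | hdvd
      · obtain ⟨j, _, hj⟩ := hq.prime.exists_mem_finset_dvd hdvd
        exact Or.inl (Or.inl ⟨j, by
          rw [realDual_eq_of_associated (hq.associated_of_dvd (hirr j) hj), hdual]⟩)
      · obtain ⟨h1, h2⟩ := hpow _ _ hq hdvd
        exact Or.inl (Or.inr ⟨Nat.lt_of_sub_pos h1, h2⟩)
    · obtain ⟨h1, h2⟩ := hpow _ _ hq hdvd
      exact Or.inr ⟨Nat.lt_of_sub_pos h1, h2⟩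
  · rintro ((⟨j, rfl⟩ | ⟨h, rfl⟩) | ⟨h, rfl⟩)
    · refine ⟨_, hirr j, ?_, (hdual j).symm⟩
      exact ((Finset.dvd_prod_of_mem _ (Finset.mem_univ j)).mul_right _).mul_right _
    · refine ⟨_, irreducible_pointPoly _, ?_, (realDual_pointPoly _).symm⟩
      exact ((dvd_pow_self _ (Nat.sub_pos_of_lt h).ne').mul_left _).mul_right _
    · refine ⟨_, irreducible_pointPoly _, ?_, (realDual_pointPoly _).symm⟩
      exact (dvd_pow_self _ (Nat.sub_pos_of_lt h).ne').mul_left _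

end Conics

theorem norm_add_sq_add_norm_sub_sq (g p : ℂ) :
    ‖g + p‖ ^ 2 + ‖g - p‖ ^ 2 = 2 * ‖g‖ ^ 2 + 2 * ‖p‖ ^ 2 := by
  simp only [← Complex.normSq_eq_norm_sq, Complex.normSq_apply, Complex.add_re, Complex.add_im,
    Complex.sub_re, Complex.sub_im]
  ring

end KreinRange

end

open KreinRange in
theorem mainTheorem4 (r s : ℕ) (hr : 0 < r) (hs : 0 < s) (α β : ℂ) (hαβ : α ≠ β)
    (C : Matrix (Fin r) (Fin s) ℂ) (D : Matrix (Fin s) (Fin r) ℂ) (hne : C ≠ 0 ∨ D ≠ 0)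
    (hCD : IsStarNormal (C * D)) (hDC : IsStarNormal (D * C)) :
    (∃ (σ δ : Fin (min r s) → ℝ) (z : Fin (min r s) → ℂ), JointLabelling C D σ δ z) ∧
    ∀ (σ δ : Fin (min r s) → ℝ) (z : Fin (min r s) → ℂ), JointLabelling C D σ δ z →
      (∀ j,
        2 * ((starRingEnd ℂ) (focusPlus α β (z j)) * focusMinus α β (z j)).re
            < ‖α‖ ^ 2 + ‖β‖ ^ 2 - σ j ^ 2 - δ j ^ 2 ∧
          ‖α‖ ^ 2 + ‖β‖ ^ 2 - σ j ^ 2 - δ j ^ 2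
            < ‖focusPlus α β (z j)‖ ^ 2 + ‖focusMinus α β (z j)‖ ^ 2) →
      ∃ H : Fin (min r s) → Set ℂ,
        (∀ j, IsHyperbola (focusPlus α β (z j)) (focusMinus α β (z j))
          (√(‖focusPlus α β (z j)‖ ^ 2 + ‖focusMinus α β (z j)‖ ^ 2
            - ‖α‖ ^ 2 - ‖β‖ ^ 2 + σ j ^ 2 + δ j ^ 2)) (H j)) ∧
        components (inertia r s) (blockMatrix α β C D) =
          Set.range H ∪ {K | s < r ∧ K = {α}} ∪ {K | r < s ∧ K = {β}} ∧
        kippenhahn (inertia r s) (blockMatrix α β C D) =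
          (⋃ j, H j) ∪ {w | s < r ∧ w = α} ∪ {w | r < s ∧ w = β} ∧
        numRange (inertia r s) (blockMatrix α β C D) =
          pseudoConvexHull (inertia r s) (blockMatrix α β C D) (⋃ j, H j) := by
  refine ⟨exists_jointLabelling r s C D hCD hDC, fun σ δ z hlab hineq => ?_⟩
  obtain ⟨W, c, d, hW, hW', hWJ, hA, hj⟩ := exists_unitary_conj_blockMatrix α β hlab
  -- centre `g`, half-difference `e` of `α`, `β`, and half-difference `p j` of the foci
  obtain ⟨g, e, rfl, rfl⟩ : ∃ g e : ℂ, g + e = α ∧ g - e = β :=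
    ⟨(α + β) / 2, (α - β) / 2, by ring, by ring⟩
  have he : e ≠ 0 := fun h => hαβ (by rw [h]; ring)
  obtain ⟨p, hpdef⟩ : ∃ p : Fin (min r s) → ℂ,
      p = fun j => ((g + e - (g - e)) ^ 2 + 4 * z j) ^ (1 / 2 : ℂ) / 2 := ⟨_, rfl⟩
  have hp : ∀ j, p j ^ 2 = e ^ 2 + d j * c j := fun j => by
    have h1 : (((g + e - (g - e)) ^ 2 + 4 * z j) ^ (1 / 2 : ℂ)) ^ 2
        = (g + e - (g - e)) ^ 2 + 4 * z j := by
      rw [one_div]; exact Complex.cpow_nat_inv_pow _ two_ne_zero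
    rw [hpdef, ← (hj j).2.2, div_pow, h1]
    ring
  have hplus : ∀ j, focusPlus (g + e) (g - e) (z j) = g + p j := fun j => by
    rw [focusPlus, hpdef]; ring
  have hminus : ∀ j, focusMinus (g + e) (g - e) (z j) = g - p j := fun j => by
    rw [focusMinus, hpdef]; ring
  simp only [hplus, hminus] at hineq ⊢
  -- a quarter of the squared length of the non-transverse axis
  obtain ⟨k, hkdef⟩ : ∃ k : Fin (min r s) → ℝ, ∀ j, 4 * k j =
      ‖g + p j‖ ^ 2 + ‖g - p j‖ ^ 2 - ‖g + e‖ ^ 2 - ‖g - e‖ ^ 2 + σ j ^ 2 + δ j ^ 2 :=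
    ⟨fun j => (‖g + p j‖ ^ 2 + ‖g - p j‖ ^ 2 - ‖g + e‖ ^ 2 - ‖g - e‖ ^ 2 + σ j ^ 2 + δ j ^ 2) / 4,
      fun j => by ring⟩
  have hk4 : ∀ j, 4 * k j = 2 * ‖p j‖ ^ 2 - 2 * ‖e‖ ^ 2 + ‖c j‖ ^ 2 + ‖d j‖ ^ 2 := fun j => by
    rw [hkdef, ← (hj j).1, ← (hj j).2.1]
    linear_combination norm_add_sq_add_norm_sub_sq g (p j) - norm_add_sq_add_norm_sub_sq g e
  have hk : ∀ j, 0 < k j := fun j => by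
    have := (hineq j).2
    have := hkdef j
    linarith
  have hpk : ∀ j, k j < ‖p j‖ ^ 2 := fun j => by
    have h1 := (hineq j).1
    have h2 : 2 * ((starRingEnd ℂ) (g + p j) * (g - p j)).re = 2 * ‖g‖ ^ 2 - 2 * ‖p j‖ ^ 2 := by
      simp only [← Complex.normSq_eq_norm_sq, Complex.normSq_apply, map_add, Complex.mul_re,
        Complex.add_re, Complex.add_im, Complex.sub_re, Complex.sub_im, Complex.conj_re,
        Complex.conj_im]
      ring
    rw [h2, (hj j).1, (hj j).2.1] at h1
    have := hk4 j
    have := norm_add_sq_add_norm_sub_sq g e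
    linarith
  have hcomp : components (inertia r s) (blockMatrix (g + e) (g - e) C D)
      = Set.range (fun j => {z | HyperbolaEq g (p j) (k j) z}) ∪ {K | s < r ∧ K = {g + e}}
        ∪ {K | r < s ∧ K = {g - e}} := by
    rw [← components_eq g e c d p k hp hk4 hk hpk, components, components, hA,
      linePoly_unitary_conj (isHermitian_inertia r s) hW' hWJ]
  refine ⟨fun j => {z | HyperbolaEq g (p j) (k j) z}, fun j => ?_, hcomp, ?_, ?_⟩
  · rw [← hkdef]
    refine ⟨Real.sqrt_pos.2 (by linarith [hk j]), 2 * √(‖p j‖ ^ 2 - k j),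
      mul_pos two_pos (Real.sqrt_pos.2 (sub_pos.2 (hpk j))), ?_, ?_⟩
    · rw [mul_pow, Real.sq_sqrt (sub_pos.2 (hpk j)).le, Real.sq_sqrt (by linarith [hk j]),
        dist_eq_norm, show g + p j - (g - p j) = 2 * p j by ring, norm_mul, mul_pow]
      norm_num
      ring
    · ext w
      exact hyperbolaEq_iff_abs_dist_sub_dist g (p j) (k j) (hk j) (hpk j) w
  · rw [kippenhahn, hcomp, Set.sUnion_union, Set.sUnion_union, Set.sUnion_range]
    congr 1
    · congr 1
      ext w; simp
    · ext w; simp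
  · have hpos := rangePos_unitary_conj (J := inertia r s)
      (A := blockMatrix (g + e) (g - e) (seqDiag r s c) (seqDiag s r d)) hW hW' hWJ
    have hneg := negRangeNeg_unitary_conj (J := inertia r s)
      (A := blockMatrix (g + e) (g - e) (seqDiag r s c) (seqDiag s r d)) hW hW' hWJ
    have hsigned : ∀ S, signed (inertia r s) (blockMatrix (g + e) (g - e) C D) S = signed
        (inertia r s) (blockMatrix (g + e) (g - e) (seqDiag r s c) (seqDiag s r d)) S := fun S => by
      funext b
      cases b <;> simp only [signed, hA, hpos, hneg]
    have hnum := numRange_eq_pseudoConvexHull g e c d p k (lt_min hr hs) he hp hk4 hk hpk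
    rw [numRange, pseudoConvexHull] at hnum ⊢
    rw [hsigned, ← hnum, hA, hpos, hneg]
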